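/- **Proposition.** Conventions. An ordinal $\alpha$ is identified with the set of smaller ordinals. Every finite alphabet $\Sigma$ contains a distinguished blank symbol $\diamond$; the blank symbol of $\Sigma^r$ is $(\diamond,\dots,\diamond)$. An $(\alpha)$-word (finite $\alpha$-word) over $\Sigma$ is a map $w:\alpha\to\Sigma$ whose support $\operatorname{supp}(w)=\{\beta<\alpha : w(\beta)\neq\diamond\}$ is finite; $\Sigma^{(\alpha)}$ denotes the set of all of them, and $\operatorname{supp}(E)=\bigcup_{e\in E}\operatorname{supp}(e)$ for $E\subseteq\Sigma^{(\alpha)}$. A tuple $(w_1,\dots,w_r)$ of $(\alpha)$-words over $\Sigma$ is regarded as the $(\alpha)$-word $\beta\mapsto(w_1(\beta),\dots,w_r(\beta))$ over $\Sigma^r$. An $(\alpha)$-automaton over an alphabet $\Sigma$ consists of a finite state set $Q$, sets $I,F\subseteq Q$ of initial and final states and a transition relation $\Delta\subseteq(Q\times\Sigma\times Q)\cup(2^Q\times Q)$. A run on $w:\alpha\to\Sigma$ is a map $r:\alpha+1\to Q$ such that $(r(\beta),w(\beta),r(\beta+1))\in\Delta$ for all $\beta<\alpha$, and $(\lim_\beta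 r,r(\beta))\in\Delta$ for all (nonzero) limit ordinals $\beta\le\alpha$, where $\lim_\beta r=\{q : \forall\beta'<\beta\ \exists\beta''\ (\beta'<\beta''<\beta,\ r(\beta'')=q)\}$. The automaton accepts $w$ if there is such a run with $r(0)\in I$ and $r(\alpha)\in F$. The relation recognised by an automaton over $\Sigma^r$ is the set of tuples $\bar w\in(\Sigma^{(\alpha)})^r$ that it accepts. For $m\in\mathbb N$ write every ordinal uniquely as $\beta=\beta_{\sim m}+\omega^m n_m+\dots+\omega n_1+n_0$ with $n_0,\dots,n_m\in\mathbb N$ and $\beta_{\sim m}$ a multiple $\omega^{m+1}\beta'$ of $\omega^{m+1}$. Let $U_m(\beta)$ be the set of all $\gamma=\gamma_{\sim m}+\omega^m l_m+\dots+\omega l_1+l_0$ such that * $\gamma=\beta$, or * $\gamma_{\sim m}=\beta_{\sim m}$, $\gamma\ne\beta$, and for the maximal $k\le m$ with $l_k\neq n_k$ we have $l_k\le n_k+m$ and $l_i\le m$ for all $i<k$, or * $\gamma_{\sim m}=\beta_{\sim m}+\omega_1 c$ for some $1\le c\le m$, and $l_i\le m$ for all $0\le i\le m$. For a set $X$ of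 ordinals let $U_m(X,\delta)=\bigl(\bigcup_{\gamma\in X\cup\{0,\delta\}}U_m(\gamma)\bigr)\cap\delta$. Statement. Let $\alpha$ be an ordinal, $\Sigma$ a finite alphabet and $\Phi=(\mathcal A_1,\dots,\mathcal A_n)$ a finite family of $(\alpha)$-automata with common finite state set $Q$, where $\mathcal A_i$ is an automaton over $\Sigma^{1+p_i}$ recognising a $(1+p_i)$-ary relation $R_i$ on $\Sigma^{(\alpha)}$, $p_i\in\mathbb N$. Put $K=|2^{Q\times Q}|^n+1$. Then for every finite set $E\subseteq\Sigma^{(\alpha)}$ and every $v\in\Sigma^{(\alpha)}$ there is $w\in\Sigma^{(\alpha)}$ with $\operatorname{supp}(w)\subseteq U_K(\operatorname{supp}(E),\alpha)$ such that $v\sim^\Phi_E w$, that is, for all $1\le i\le n$ and all $e_1,\dots,e_{p_i}\in E$, $$(v,e_1,\dots,e_{p_i})\in R_i\iff(w,e_1,\dots,e_{p_i})\in R_i .$$ -/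

import Mathlib

namespace OrdinalAutomata

open Ordinal

universe u v w

/-! ### Cantor normal form below a finite exponent -/

/-- `β_{∼n}`: the largest multiple of `ω ^ (n + 1)` that is at most `β`. -/
noncomputable def trunc (n : ℕ) (β : Ordinal.{u}) : Ordinal.{u} :=
  ω ^ (n + 1) * (β / ω ^ (n + 1))

/-- The coefficient of `ω ^ i` in the Cantor normal form of `β` (a finite ordinal). -/
noncomputable def coeff (i : ℕ) (β : Ordinal.{u}) : Ordinal.{u} :=
  (β % ω ^ (i + 1)) / ω ^ i

theorem coeff_lt_omega0 (i : ℕ) (β : Ordinal.{u}) : coeff i β < ω := by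
  have h : β % ω ^ (i + 1) < ω ^ i * ω := by
    rw [← pow_succ]
    exact Ordinal.mod_lt _ (pow_ne_zero _ omega0_ne_zero)
  exact (Ordinal.lt_mul_iff_div_lt (pow_ne_zero _ omega0_ne_zero)).1 h

/-- Together with `trunc_succ_add`, this is the decomposition
`β = β_{∼n} + ω ^ n * m_n + ⋯ + ω * m_1 + m_0`, where `m_i = coeff i β`. -/
theorem trunc_zero_add (β : Ordinal.{u}) : trunc 0 β + coeff 0 β = β := by
  simp [trunc, coeff, Ordinal.div_add_mod]

theorem trunc_succ_add (n : ℕ) (β : Ordinal.{u}) :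
    trunc (n + 1) β + ω ^ (n + 1) * coeff (n + 1) β = trunc n β := by
  have h0 : (ω : Ordinal.{u}) ^ (n + 1) ≠ 0 := pow_ne_zero _ omega0_ne_zero
  have hβ : β / ω ^ (n + 1) =
      ω * (β / ω ^ (n + 2)) + (β % ω ^ (n + 2)) / ω ^ (n + 1) := by
    conv_lhs => rw [← Ordinal.div_add_mod β (ω ^ (n + 2)), pow_succ ω (n + 1), mul_assoc]
    rw [Ordinal.mul_add_div _ h0, ← pow_succ ω (n + 1)]
  unfold trunc coeff
  rw [hβ, mul_add, ← mul_assoc, ← pow_succ]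

/-! ### The sets `U_m(β)` and `U_m(X, δ)` -/

/-- `U_m(β)`. -/
def U (m : ℕ) (β : Ordinal.{u}) : Set Ordinal.{u} :=
  {γ | γ = β ∨
    (trunc m γ = trunc m β ∧
      ∃ k ≤ m, coeff k γ ≠ coeff k β ∧ (∀ j ≤ m, k < j → coeff j γ = coeff j β) ∧
        coeff k γ ≤ coeff k β + (m : Ordinal.{u}) ∧
        ∀ i < k, coeff i γ ≤ (m : Ordinal.{u})) ∨
    (∃ c : ℕ, 1 ≤ c ∧ c ≤ m ∧ trunc m γ = trunc m β + ω₁ * (c : Ordinal.{u}) ∧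
      ∀ i ≤ m, coeff i γ ≤ (m : Ordinal.{u}))}

/-- `U_m(X, δ)`: the union of the `U_m(γ)` for `γ ∈ X ∪ {0, δ}`, intersected with `δ`. -/
def USet (m : ℕ) (X : Set Ordinal.{u}) (δ : Ordinal.{u}) : Set Ordinal.{u} :=
  (⋃ γ ∈ X ∪ {0, δ}, U m γ) ∩ Set.Iio δ

/-! ### Finite `α`-words -/

/-- A finite `α`-word over the alphabet `S` with blank symbol `blank`: a map from the ordinals
below `α` to `S` that differs from the blank symbol at finitely many positions only. -/
structure FinWord (α : Ordinal.{u}) (S : Type v) (blank : S) where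
  letter : Set.Iio α → S
  finite_support : {β | letter β ≠ blank}.Finite

variable {α : Ordinal.{u}} {S : Type v} {blank : S} {Q : Type w}

/-- The support of a finite `α`-word, as a set of ordinals. -/
def FinWord.supp (x : FinWord α S blank) : Set Ordinal.{u} :=
  {β | ∃ h : β < α, x.letter ⟨β, h⟩ ≠ blank}

/-- The support of a set of finite `α`-words. -/
def suppSet (E : Set (FinWord α S blank)) : Set Ordinal.{u} :=
  ⋃ e ∈ E, e.supp

/-- The convolution of a tuple of finite `α`-words over `S`, a finite `α`-word over `S ^ r` whose
blank symbol is the tuple of blank symbols. -/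
def convolution {r : ℕ} (x : Fin r → FinWord α S blank) :
    FinWord α (Fin r → S) (fun _ => blank) where
  letter β := fun j => (x j).letter β
  finite_support := by
    refine (Set.finite_iUnion fun j => (x j).finite_support).subset ?_
    intro β hβ
    obtain ⟨j, hj⟩ := Function.ne_iff.1 hβ
    exact Set.mem_iUnion.2 ⟨j, hj⟩

/-! ### Ordinal automata -/

/-- An ordinal automaton with state set `Q` over the alphabet `S`. The transition relation is
given by its two parts, contained in `Q × S × Q` and `2 ^ Q × Q` respectively. -/
structure OrdinalAutomaton (Q : Type w) (S : Type v) where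
  init : Set Q
  final : Set Q
  succTrans : Set (Q × S × Q)
  limTrans : Set (Set Q × Q)

/-- The set of images of `r : α + 1 → Q` that are cofinal in `β`. -/
def limSet (r : Set.Iic α → Q) (β : Set.Iic α) : Set Q :=
  {q | ∀ β' < β, ∃ β'', β' < β'' ∧ β'' < β ∧ r β'' = q}

/-- `r : α + 1 → Q` is a run of `A` on the word `x`. (`Order.IsSuccLimit` excludes `0`.) -/
def IsRun (A : OrdinalAutomaton Q S) (x : FinWord α S blank) (r : Set.Iic α → Q) : Prop :=
  (∀ (β : Ordinal.{u}) (h : β < α),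
    (r ⟨β, h.le⟩, x.letter ⟨β, h⟩, r ⟨β + 1, Order.add_one_le_of_lt h⟩) ∈ A.succTrans) ∧
  ∀ β : Set.Iic α, Order.IsSuccLimit (β : Ordinal.{u}) → (limSet r β, r β) ∈ A.limTrans

/-- `A` accepts `x`, i.e. there is an accepting run of `A` on `x`. -/
def Accepts (A : OrdinalAutomaton Q S) (x : FinWord α S blank) : Prop :=
  ∃ r : Set.Iic α → Q, IsRun A x r ∧
    r ⟨0, Set.mem_Iic.2 zero_le⟩ ∈ A.init ∧ r ⟨α, le_refl α⟩ ∈ A.final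

/-- The `r`-ary relation on finite `α`-words over `S` recognised by an automaton over `S ^ r`. -/
def recognised (α : Ordinal.{u}) (blank : S) {r : ℕ} (A : OrdinalAutomaton Q (Fin r → S)) :
    Set (Fin r → FinWord α S blank) :=
  {x | Accepts A (convolution x)}

/-- `x ∼^Φ_E y`: no automaton of the family `Φ`, whose `i`-th member recognises a relation of arity
`p i + 1`, can tell `x` from `y` using parameters from `E`. -/
def Indistinguishable {n : ℕ} {p : Fin n → ℕ}
    (Φ : (i : Fin n) → OrdinalAutomaton Q (Fin (p i + 1) → S))
    (E : Set (FinWord α S blank)) (x y : FinWord α S blank) : Prop :=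
  ∀ (i : Fin n) (e : Fin (p i) → FinWord α S blank), (∀ j, e j ∈ E) →
    ((Fin.cons x e : Fin (p i + 1) → FinWord α S blank) ∈ recognised α blank (Φ i) ↔
      (Fin.cons y e : Fin (p i + 1) → FinWord α S blank) ∈ recognised α blank (Φ i))

end OrdinalAutomata

/-! The type of a segment of a word is the family of relations on `Q` given by the endpoints of the
runs on it, one relation for each automaton. Types of adjacent segments multiply (`runRel_mul`) in a
finite monoid of size N = |2^(Q×Q)|^n, so exchanging a segment for one of the same type does not
affect acceptance. Strictly between consecutive points of supp(E) ∪ {0, α} all parameters are blank.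
There `v` is the only relevant track, and the same n types serve all tuples from `E`; this is why
the bound does not depend on `E`. It remains to replace `v` on each such gap (γ, γ') by a word of
the same type supported in U(γ) ∪ U(γ') (`Realizes.replace_segment`).

Two compressions achieve this. First, by pigeonhole on prefix products, every product in the monoid
equals the product of fewer than N of its factors (`exists_short_sublist_prod_eq`). By finiteness of
the support, all but finitely many blocks of an ω-sequence of blocks are blank, so compressing level
by level makes the Cantor normal form coefficients of the support small
(`Realizes.restrict_smallCoeff`).

Second, for m > |Q| and β ≠ 0 the type of the blank word of length ω^m β depends only on whether
that length has countable cofinality (`runRel_const_of_cofOmega`, `runRel_const_of_not_cofOmega`). A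
limit transition sees only the set of recurring states. Either a block already recurs to the full
set, and the run can be cut or pumped there, or all late blocks have smaller recurring sets and
induction on the size of the set applies. For uncountable cofinality a closing-off argument finds an
earlier limit with the same recurring set. Long blank stretches may thus be replaced by ω^m or by
ω₁, which is the origin of the terms ω₁ c in U (`Realizes.replace_middle`). -/

namespace OrdinalAutomata

open Ordinal Order

universe u v w

/-! ### Runs on intervals of ordinals: restriction, translation, gluing -/

section Runs

variable {Q : Type w} {S : Type v}

/-- The set of values that `r` takes cofinally often below `β`. -/
def cofinalSet (r : Ordinal.{u} → Q) (β : Ordinal.{u}) : Set Q :=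
  {q | ∀ β' < β, ∃ β'', β' < β'' ∧ β'' < β ∧ r β'' = q}

theorem cofinalSet_subset_of_eq {r r' : Ordinal.{u} → Q} {a β : Ordinal.{u}} (ha : a < β)
    (h : ∀ x, a ≤ x → x < β → r x = r' x) : cofinalSet r β ⊆ cofinalSet r' β := by
  intro q hq β' hβ'
  obtain ⟨x, hx, hxβ, rfl⟩ := hq (max a β') (max_lt ha hβ')
  have hax : a ≤ x := (le_max_left _ _).trans hx.le
  exact ⟨x, (le_max_right _ _).trans_lt hx, hxβ, (h x hax hxβ).symm⟩

theorem cofinalSet_congr {r r' : Ordinal.{u} → Q} {a β : Ordinal.{u}} (ha : a < β)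
    (h : ∀ x, a ≤ x → x < β → r x = r' x) : cofinalSet r β = cofinalSet r' β :=
  (cofinalSet_subset_of_eq ha h).antisymm
    (cofinalSet_subset_of_eq ha fun x h1 h2 => (h x h1 h2).symm)

theorem cofinalSet_shift (r : Ordinal.{u} → Q) (a : Ordinal.{u}) {l : Ordinal.{u}}
    (hl : 0 < l) : cofinalSet r (a + l) = cofinalSet (fun x => r (a + x)) l := by
  ext q
  constructor
  · intro h β' hβ'
    obtain ⟨x, hx, hxl, rfl⟩ := h (a + β') (by simpa using hβ')
    have hax : a ≤ x := le_self_add.trans hx.le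
    rw [← Ordinal.add_sub_cancel_of_le hax] at hx hxl
    refine ⟨x - a, by simpa using hx, by simpa using hxl, ?_⟩
    simp only [Ordinal.add_sub_cancel_of_le hax]
  · intro h β' hβ'
    have : β' - a < l := sub_lt_of_lt_add hβ' hl
    obtain ⟨x, hx, hxl, rfl⟩ := h (β' - a) this
    exact ⟨a + x, lt_of_le_of_lt (le_add_sub β' a) (by simpa using hx), by simpa using hxl, rfl⟩

/-- `r` is a run of `A` on the letters of `x` at the positions `β` with `a ≤ β < b`. -/
structure RunOn (A : OrdinalAutomaton Q S) (x : Ordinal.{u} → S) (a b : Ordinal.{u})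
    (r : Ordinal.{u} → Q) : Prop where
  succ : ∀ β, a ≤ β → β < b → (r β, x β, r (β + 1)) ∈ A.succTrans
  lim : ∀ β, a < β → β ≤ b → IsSuccLimit β → (cofinalSet r β, r β) ∈ A.limTrans

namespace RunOn

variable {A : OrdinalAutomaton Q S} {x x' : Ordinal.{u} → S} {a b c l : Ordinal.{u}}
  {r r' : Ordinal.{u} → Q}

theorem mono (h : RunOn A x a b r) {a' b' : Ordinal.{u}} (ha : a ≤ a') (hb : b' ≤ b) :
    RunOn A x a' b' r :=
  ⟨fun β h1 h2 => h.succ β (ha.trans h1) (h2.trans_le hb),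
    fun β h1 h2 => h.lim β (ha.trans_lt h1) (h2.trans hb)⟩

theorem trans (h1 : RunOn A x a b r) (h2 : RunOn A x b c r) : RunOn A x a c r := by
  constructor
  · intro β ha hc
    rcases lt_or_ge β b with h | h
    · exact h1.succ β ha h
    · exact h2.succ β h hc
  · intro β ha hc
    rcases le_or_gt β b with h | h
    · exact h1.lim β ha h
    · exact h2.lim β h hc

theorem refl (A : OrdinalAutomaton Q S) (x : Ordinal.{u} → S) (a : Ordinal.{u})
    (r : Ordinal.{u} → Q) : RunOn A x a a r :=
  ⟨fun _ h1 h2 => absurd h1 h2.not_ge, fun _ h1 h2 => absurd h1 h2.not_gt⟩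

theorem congr (h : RunOn A x a b r) (hr : ∀ y, a ≤ y → y ≤ b → r' y = r y)
    (hx : ∀ y, a ≤ y → y < b → x' y = x y) : RunOn A x' a b r' := by
  constructor
  · intro β h1 h2
    rw [hr β h1 h2.le, hx β h1 h2, hr (β + 1) (h1.trans le_self_add) (add_one_le_of_lt h2)]
    exact h.succ β h1 h2
  · intro β h1 h2 h3
    rw [hr β h1.le h2, cofinalSet_congr h1 fun y ha hb => hr y ha (hb.le.trans h2)]
    exact h.lim β h1 h2 h3

theorem unshift (h : RunOn A x a (a + l) r) (hx : ∀ y < l, x' y = x (a + y)) :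
    RunOn A x' 0 l (fun y => r (a + y)) := by
  constructor
  · intro β _ h2
    rw [hx β h2, ← add_assoc]
    exact h.succ _ le_self_add (by simpa using h2)
  · intro β h1 h2 h3
    rw [← cofinalSet_shift r a h1]
    exact h.lim _ (by simpa using h1) (by simpa using h2) (isSuccLimit_add a h3)

theorem shift (h : RunOn A x 0 l r) (hx : ∀ y < l, x' (a + y) = x y) :
    RunOn A x' a (a + l) (fun z => r (z - a)) := by
  constructor
  · intro β h1 h2
    obtain ⟨y, rfl⟩ := exists_add_of_le h1
    have h2 : y < l := by simpa using h2
    rw [hx y h2, add_assoc, Ordinal.add_sub_cancel, Ordinal.add_sub_cancel]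
    exact h.succ y zero_le h2
  · intro β h1 h2 h3
    obtain ⟨y, rfl⟩ := exists_add_of_le h1.le
    have h2 : y ≤ l := by simpa using h2
    have h1 : 0 < y := by simpa using h1
    rw [cofinalSet_shift _ _ h1]
    simp only [Ordinal.add_sub_cancel]
    refine h.lim y h1 h2 ?_
    rcases isSuccLimit_add_iff.1 h3 with h | h
    · exact h
    · exact absurd h.1 h1.ne'

theorem glue (h1 : RunOn A x a b r) (h2 : RunOn A x b c r') (h : r b = r' b) :
    RunOn A x a c (fun y => if y < b then r y else r' y) := by
  refine (h1.congr ?_ fun _ _ _ => rfl).trans (h2.congr ?_ fun _ _ _ => rfl)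
  · intro y _ hy
    split_ifs with hyb
    · rfl
    · rw [le_antisymm hy (not_lt.1 hyb), h]
  · intro y hy _
    rw [if_neg hy.not_gt]

end RunOn

/-- The runs `r k` on `[s k, s (k + 1)]` glued together. -/
noncomputable def glueSeq (s : ℕ → Ordinal.{u}) (r : ℕ → Ordinal.{u} → Q) (x : Ordinal.{u}) : Q :=
  r (sInf {k | x < s (k + 1)}) x

theorem glueSeq_of_lt {s : ℕ → Ordinal.{u}} (hs : StrictMono s) (r : ℕ → Ordinal.{u} → Q) {k : ℕ}
    {x : Ordinal.{u}} (h1 : s k ≤ x) (h2 : x < s (k + 1)) : glueSeq s r x = r k x := by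
  have : sInf {k | x < s (k + 1)} = k := by
    refine le_antisymm (Nat.sInf_le h2) (le_csInf ⟨k, h2⟩ fun j hj => ?_)
    have := hs.lt_iff_lt.1 (h1.trans_lt hj)
    omega
  rw [glueSeq, this]

theorem glueSeq_of_le {s : ℕ → Ordinal.{u}} (hs : StrictMono s) {r : ℕ → Ordinal.{u} → Q}
    (h : ∀ k, r k (s (k + 1)) = r (k + 1) (s (k + 1))) {k : ℕ}
    {x : Ordinal.{u}} (h1 : s k ≤ x) (h2 : x ≤ s (k + 1)) : glueSeq s r x = r k x := by
  rcases h2.lt_or_eq with h2 | rfl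
  · exact glueSeq_of_lt hs r h1 h2
  · rw [h, glueSeq_of_lt hs r le_rfl (hs (by omega))]

theorem RunOn.glueSeq {A : OrdinalAutomaton Q S} {x : Ordinal.{u} → S} {s : ℕ → Ordinal.{u}}
    (hs : StrictMono s) {r : ℕ → Ordinal.{u} → Q}
    (hr : ∀ k, RunOn A x (s k) (s (k + 1)) (r k))
    (h : ∀ k, r k (s (k + 1)) = r (k + 1) (s (k + 1))) (k : ℕ) :
    RunOn A x (s 0) (s k) (glueSeq s r) := by
  induction k with
  | zero => exact RunOn.refl _ _ _ _
  | succ k ih =>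
    exact ih.trans ((hr k).congr (fun y h1 h2 => glueSeq_of_le hs h h1 h2) fun _ _ _ => rfl)

end Runs

/-! ### Runs on blank words and their sets of values -/

section Blank

variable {Q : Type w} {S : Type v}

/-- `A` has a run from `q` to `q'` on `l` letters `b`, and `V` is the set of its values at the
positions below `l`. -/
def Traverse (A : OrdinalAutomaton Q S) (b : S) (l : Ordinal.{u}) (q : Q) (V : Set Q) (q' : Q) :
    Prop :=
  ∃ r : Ordinal.{u} → Q, RunOn A (fun _ => b) 0 l r ∧ r 0 = q ∧ r l = q' ∧ r '' Set.Iio l = V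

/-- `A` has a run from `q` on the letters `b` at the positions below `l`, where `V` is the set of
its values and `P` the set of the values that are cofinal in `l`. -/
def Approach (A : OrdinalAutomaton Q S) (b : S) (l : Ordinal.{u}) (q : Q) (V P : Set Q) : Prop :=
  ∃ r : Ordinal.{u} → Q, (∀ c < l, RunOn A (fun _ => b) 0 c r) ∧ r 0 = q ∧ r '' Set.Iio l = V ∧
    cofinalSet r l = P

/-- A strictly increasing sequence starting with `0` and with supremum `l`. -/
structure IsLadder (s : ℕ → Ordinal.{u}) (l : Ordinal.{u}) : Prop where
  strictMono : StrictMono s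
  zero : s 0 = 0
  lt : ∀ k, s k < l
  exists_lt : ∀ x < l, ∃ k, x < s k

variable {A : OrdinalAutomaton Q S} {b : S} {l l₁ l₂ : Ordinal.{u}} {q q' p : Q}
  {V V₁ V₂ P : Set Q}

theorem cofinalSet_subset_image (r : Ordinal.{u} → Q) {a : Ordinal.{u}} (h : a < l) :
    cofinalSet r l ⊆ r '' Set.Ico a l := by
  intro q hq
  obtain ⟨x, h1, h2, rfl⟩ := hq a h
  exact ⟨x, ⟨h1.le, h2⟩, rfl⟩

/-- Each non-recurring state has a bound below `l` past which it is absent; with finitely many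
states these bounds have a maximum. -/
theorem exists_image_subset_cofinalSet [Finite Q] (r : Ordinal.{u} → Q) (hl : IsSuccLimit l) :
    ∃ a < l, r '' Set.Ico a l ⊆ cofinalSet r l := by
  have h : ∀ q : Q, ∃ a < l, q ∉ cofinalSet r l → ∀ x, a < x → x < l → r x ≠ q := by
    intro q
    by_cases hq : q ∈ cofinalSet r l
    · exact ⟨0, hl.bot_lt, fun h => absurd hq h⟩
    · simp only [cofinalSet, Set.mem_ofPred_eq, not_forall, not_exists, not_and] at hq
      obtain ⟨a, ha, h⟩ := hq
      exact ⟨a, ha, fun _ => h⟩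
  choose f hf hf' using h
  have : Nonempty Q := ⟨r 0⟩
  obtain ⟨q₀, hq₀⟩ := Finite.exists_max f
  refine ⟨f q₀ + 1, hl.add_one_lt (hf q₀), ?_⟩
  rintro _ ⟨x, ⟨h1, h2⟩, rfl⟩
  by_contra hc
  exact hf' _ hc x ((hq₀ _).trans_lt (lt_of_lt_of_le (lt_add_one _) h1)) h2 rfl

theorem image_Ico_add (r : Ordinal.{u} → Q) (a l : Ordinal.{u}) :
    r '' Set.Ico a (a + l) = (fun y => r (a + y)) '' Set.Iio l := by
  ext q
  constructor
  · rintro ⟨x, ⟨h1, h2⟩, rfl⟩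
    obtain ⟨y, rfl⟩ := exists_add_of_le h1
    exact ⟨y, by simpa using h2, rfl⟩
  · rintro ⟨y, hy, rfl⟩
    exact ⟨a + y, ⟨le_self_add, by simpa using hy⟩, rfl⟩

theorem image_Iio_add (r : Ordinal.{u} → Q) (l₁ l₂ : Ordinal.{u}) :
    r '' Set.Iio (l₁ + l₂) = r '' Set.Iio l₁ ∪ (fun y => r (l₁ + y)) '' Set.Iio l₂ := by
  rw [← image_Ico_add, ← Set.image_union, Set.Iio_union_Ico_eq_Iio le_self_add]

theorem Traverse.zero (A : OrdinalAutomaton Q S) (b : S) (q : Q) :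
    Traverse A b (0 : Ordinal.{u}) q ∅ q :=
  ⟨fun _ => q, RunOn.refl _ _ _ _, rfl, rfl, by simp⟩

theorem Traverse.of_runOn {r : Ordinal.{u} → Q} {a : Ordinal.{u}}
    (h : RunOn A (fun _ => b) a (a + l) r) :
    Traverse A b l (r a) (r '' Set.Ico a (a + l)) (r (a + l)) :=
  ⟨fun y => r (a + y), h.unshift fun _ _ => rfl, by simp, rfl, (image_Ico_add r a l).symm⟩

theorem Traverse.add (h1 : Traverse A b l₁ q V₁ p) (h2 : Traverse A b l₂ p V₂ q') :
    Traverse A b (l₁ + l₂) q (V₁ ∪ V₂) q' := by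
  obtain ⟨r₁, h1, rfl, rfl, rfl⟩ := h1
  obtain ⟨r₂, h2, h3, rfl, rfl⟩ := h2
  have h := h1.glue (h2.shift (a := l₁) fun _ _ => rfl) (by simpa using h3.symm)
  refine ⟨_, h, ?_, ?_, ?_⟩
  · by_cases hl : 0 < l₁
    · simp [hl]
    · have : l₁ = 0 := by simpa using hl
      subst this
      simpa using h3
  · simp
  · rw [image_Iio_add]
    congr 1
    · exact Set.image_congr fun x hx => by simp [show x < l₁ from hx]
    · exact Set.image_congr fun x hx => by simp

theorem Traverse.addApproach (h1 : Traverse A b l₁ q V₁ p) (h2 : Approach A b l₂ p V₂ P)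
    (hl : 0 < l₂) : Approach A b (l₁ + l₂) q (V₁ ∪ V₂) P := by
  obtain ⟨r₁, h1, rfl, rfl, rfl⟩ := h1
  obtain ⟨r₂, h2, h3, rfl, rfl⟩ := h2
  refine ⟨fun y => if y < l₁ then r₁ y else r₂ (y - l₁), fun c hc => ?_, ?_, ?_, ?_⟩
  · refine RunOn.mono (b := l₁ + (c - l₁)) ?_ le_rfl (le_add_sub _ _)
    exact h1.glue ((h2 (c - l₁) (sub_lt_of_lt_add hc hl)).shift (a := l₁) fun _ _ => rfl)
      (by simpa using h3.symm)
  · by_cases hl : 0 < l₁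
    · simp [hl]
    · have : l₁ = 0 := by simpa using hl
      subst this
      simpa using h3
  · rw [image_Iio_add]
    congr 1
    · exact Set.image_congr fun x hx => by simp [show x < l₁ from hx]
    · exact Set.image_congr fun x hx => by simp
  · rw [cofinalSet_shift _ _ hl]
    congr 1
    ext y
    simp

theorem Approach.split (h : Approach A b (l₁ + l₂) q V P) (hl : 0 < l₂) :
    ∃ V₁ V₂ p, V = V₁ ∪ V₂ ∧ Traverse A b l₁ q V₁ p ∧ Approach A b l₂ p V₂ P := by
  obtain ⟨r, h, rfl, rfl, rfl⟩ := h
  exact ⟨_, _, r l₁, image_Iio_add r l₁ l₂,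
    ⟨r, h _ (by simpa using hl), rfl, rfl, rfl⟩,
    ⟨fun y => r (l₁ + y), fun c hc => ((h (l₁ + c) (by simpa using hc)).mono
      zero_le le_rfl).unshift fun _ _ => rfl, by simp, rfl, (cofinalSet_shift r l₁ hl).symm⟩⟩

theorem Approach.traverse (h : Approach A b l q V P) (hl : IsSuccLimit l)
    (hq : (P, q') ∈ A.limTrans) : Traverse A b l q V q' := by
  obtain ⟨r, h, rfl, rfl, rfl⟩ := h
  have hne : (0 : Ordinal.{u}) ≠ l := hl.bot_lt.ne
  have hr : ∀ x < l, Function.update r l q' x = r x := fun x hx => Function.update_of_ne hx.ne _ _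
  refine ⟨Function.update r l q', ⟨fun β _ h2 => ?_, fun β h1 h2 h3 => ?_⟩, hr 0 hl.bot_lt,
    Function.update_self _ _ _, Set.image_congr hr⟩
  · rw [hr β h2, hr _ (hl.add_one_lt h2)]
    exact (h (β + 1) (hl.add_one_lt h2)).succ β zero_le (lt_add_one β)
  · rw [cofinalSet_congr h1 fun x _ hx => hr x (hx.trans_le h2)]
    rcases h2.lt_or_eq with h2 | rfl
    · rw [hr β h2]
      exact (h β h2).lim β h1 le_rfl h3
    · rwa [Function.update_self]

theorem Traverse.approach (h : Traverse A b l q V q') (hl : IsSuccLimit l) :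
    ∃ P, Approach A b l q V P ∧ (P, q') ∈ A.limTrans := by
  obtain ⟨r, h, rfl, rfl, rfl⟩ := h
  exact ⟨_, ⟨r, fun c hc => h.mono le_rfl hc.le, rfl, rfl, rfl⟩, h.lim l hl.bot_lt le_rfl hl⟩

theorem Approach.subset (h : Approach A b l q V P) (hl : 0 < l) : P ⊆ V := by
  obtain ⟨r, h, rfl, rfl, rfl⟩ := h
  exact (cofinalSet_subset_image r hl).trans (Set.image_mono Set.Ico_subset_Iio_self)

theorem Approach.nonempty [Finite Q] (h : Approach A b l q V P) (hl : IsSuccLimit l) :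
    P.Nonempty := by
  obtain ⟨r, h, rfl, rfl, rfl⟩ := h
  obtain ⟨a, ha, h⟩ := exists_image_subset_cofinalSet r hl
  exact ⟨r a, h ⟨a, ⟨le_rfl, ha⟩, rfl⟩⟩

theorem IsLadder.image_Iio {s : ℕ → Ordinal.{u}} (hs : IsLadder s l) (r : Ordinal.{u} → Q) :
    r '' Set.Iio l = ⋃ k, r '' Set.Ico (s k) (s (k + 1)) := by
  rw [← Set.image_iUnion]
  congr 1
  ext x
  simp only [Set.mem_Iio, Set.mem_iUnion, Set.mem_Ico]
  constructor
  · intro hx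
    have h := hs.exists_lt x hx
    refine ⟨Nat.find h - 1, ?_, ?_⟩
    · by_contra hc
      have h1 := Nat.find_min' h (not_le.1 hc)
      have h2 : Nat.find h = 0 := by omega
      have h3 := Nat.find_spec h
      rw [h2, hs.zero] at h3
      exact not_lt_zero h3
    · exact (Nat.find_spec h).trans_le (hs.strictMono.monotone (by omega))
  · rintro ⟨k, _, hk⟩
    exact hk.trans (hs.lt _)

theorem IsLadder.exists_mem_Ico {s : ℕ → Ordinal.{u}} (hs : IsLadder s l) {x : Ordinal.{u}}
    (hx : x < l) : ∃ k, s k ≤ x ∧ x < s (k + 1) := by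
  have h := hs.image_Iio (fun x => x)
  simp only [Set.image_id'] at h
  have : x ∈ Set.Iio l := hx
  rw [h] at this
  simpa using this

theorem IsLadder.cofinalSet_eq {s : ℕ → Ordinal.{u}} (hs : IsLadder s l) (r : Ordinal.{u} → Q) :
    cofinalSet r l = {q | ∀ n, ∃ k ≥ n, q ∈ r '' Set.Ico (s k) (s (k + 1))} := by
  ext q
  constructor
  · intro h n
    obtain ⟨x, h1, h2, rfl⟩ := h (s n) (hs.lt n)
    obtain ⟨k, hk, hk'⟩ := hs.exists_mem_Ico h2
    have := hs.strictMono.lt_iff_lt.1 (h1.trans hk')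
    exact ⟨k, by omega, x, ⟨hk, hk'⟩, rfl⟩
  · intro h x hx
    obtain ⟨n, hn⟩ := hs.exists_lt x hx
    obtain ⟨k, hk, y, ⟨h1, h2⟩, rfl⟩ := h n
    exact ⟨y, hn.trans_le ((hs.strictMono.monotone hk).trans h1), h2.trans (hs.lt _), rfl⟩

theorem Approach.of_ladder {s : ℕ → Ordinal.{u}} (hs : IsLadder s l) {p : ℕ → Q} {V : ℕ → Set Q}
    (h : ∀ k, Traverse A b (s (k + 1) - s k) (p k) (V k) (p (k + 1))) :
    Approach A b l (p 0) (⋃ k, V k) {q | ∀ n, ∃ k ≥ n, q ∈ V k} := by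
  choose r hr hr0 hr1 hrV using h
  have hle : ∀ k, s k + (s (k + 1) - s k) = s (k + 1) := fun k =>
    Ordinal.add_sub_cancel_of_le (hs.strictMono.monotone (by omega))
  have hrun : ∀ k, RunOn A (fun _ => b) (s k) (s (k + 1)) (fun z => r k (z - s k)) := by
    intro k
    have := (hr k).shift (x' := fun _ => b) (a := s k) fun _ _ => rfl
    rwa [hle] at this
  have hglue : ∀ k, r k (s (k + 1) - s k) = r (k + 1) (s (k + 1) - s (k + 1)) := by
    intro k
    rw [hr1, Ordinal.sub_self, hr0]
  have hV : ∀ k, glueSeq s (fun k z => r k (z - s k)) '' Set.Ico (s k) (s (k + 1)) = V k := by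
    intro k
    rw [← hrV k, Set.image_congr fun x hx => glueSeq_of_lt hs.strictMono _ hx.1 hx.2]
    conv_lhs => rw [← hle k]
    rw [image_Ico_add]
    simp only [Ordinal.add_sub_cancel]
  refine ⟨glueSeq s fun k z => r k (z - s k), fun c hc => ?_, ?_, ?_, ?_⟩
  · obtain ⟨k, hk⟩ := hs.exists_lt c hc
    have := RunOn.glueSeq hs.strictMono hrun hglue k
    rw [hs.zero] at this
    exact this.mono le_rfl hk.le
  · rw [glueSeq_of_lt (k := 0) hs.strictMono _ hs.zero.le
      (hs.zero ▸ hs.strictMono (Nat.lt_succ_self 0)), hs.zero, Ordinal.sub_zero, hr0]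
  · rw [hs.image_Iio]
    exact Set.iUnion_congr hV
  · simp only [hs.cofinalSet_eq, hV]

theorem Approach.ladder {s : ℕ → Ordinal.{u}} (hs : IsLadder s l) (h : Approach A b l q V P) :
    ∃ (p : ℕ → Q) (W : ℕ → Set Q), p 0 = q ∧ V = ⋃ k, W k ∧ P = {q | ∀ n, ∃ k ≥ n, q ∈ W k} ∧
      ∀ k, Traverse A b (s (k + 1) - s k) (p k) (W k) (p (k + 1)) := by
  obtain ⟨r, h, rfl, rfl, rfl⟩ := h
  refine ⟨fun k => r (s k), fun k => r '' Set.Ico (s k) (s (k + 1)), by simp [hs.zero],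
    hs.image_Iio r, hs.cofinalSet_eq r, fun k => ?_⟩
  have hle : s k + (s (k + 1) - s k) = s (k + 1) :=
    Ordinal.add_sub_cancel_of_le (hs.strictMono.monotone (by omega))
  have := Traverse.of_runOn (A := A) (b := b) (l := s (k + 1) - s k) (a := s k) (r := r)
    (by rw [hle]; exact (h _ (hs.lt (k + 1))).mono zero_le le_rfl)
  rwa [hle] at this

theorem Traverse.mul_nat {p : ℕ → Q} {V : ℕ → Set Q}
    (h : ∀ k, Traverse A b l (p k) (V k) (p (k + 1))) (c : ℕ) :
    Traverse A b (l * c) (p 0) (⋃ k < c, V k) (p c) := by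
  induction c with
  | zero => simpa using Traverse.zero A b (p 0)
  | succ c ih =>
    have := ih.add (h c)
    rwa [Nat.cast_succ, mul_add_one, Set.biUnion_lt_succ]

/-- Pumping: the approach is repeated periodically, as `r (x % l)`. Every copy visits exactly `P`
and has limit set `P`, so every nonzero multiple of `l` has limit set `P` and may carry the state
`p` that starts the next copy. -/
theorem Approach.mul (h : Approach A b l p P P) (hl : IsSuccLimit l)
    (hp : (P, p) ∈ A.limTrans) {γ : Ordinal.{u}} (hγ : γ ≠ 0) : Approach A b (l * γ) p P P := by
  obtain ⟨r, h, rfl, hV, hP⟩ := h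
  have hl0 : 0 < l := hl.bot_lt
  have hval : ∀ ξ, ∀ y < l, r ((l * ξ + y) % l) = r y := fun ξ y hy => by
    rw [mul_add_mod_self, mod_eq_of_lt hy]
  have hcof : ∀ ξ, ξ ≠ 0 → cofinalSet (fun x => r (x % l)) (l * ξ) = P := by
    intro ξ hξ
    apply Set.Subset.antisymm
    · intro q hq
      obtain ⟨x, _, _, rfl⟩ := hq 0 (mul_pos hl0 (pos_iff_ne_zero.2 hξ))
      exact hV ▸ ⟨_, mod_lt _ hl0.ne', rfl⟩
    · intro q hq x hx
      obtain ⟨ζ, hζ, y, hy, rfl⟩ := lt_mul_iff.1 hx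
      rw [← hP] at hq
      obtain ⟨z, hz, hzl, rfl⟩ := hq y hy
      refine ⟨l * ζ + z, by simpa using hz, ?_, hval ζ z hzl⟩
      calc l * ζ + z < l * ζ + l := by simpa using hzl
        _ = l * (ζ + 1) := by rw [mul_add_one]
        _ ≤ l * ξ := by gcongr; exact add_one_le_of_lt hζ
  refine ⟨fun x => r (x % l), fun c hc => ⟨fun β _ hβ => ?_, fun β hβ hβc hlim => ?_⟩, by simp,
    ?_, hcof γ hγ⟩
  · obtain ⟨ζ, _, y, hy, rfl⟩ := lt_mul_iff.1 (hβ.trans hc)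
    have hy1 := hl.add_one_lt hy
    simp only [add_assoc, hval ζ y hy, hval ζ (y + 1) hy1]
    exact (h (y + 1) hy1).succ y zero_le (lt_add_one y)
  · obtain ⟨ζ, _, y, hy, rfl⟩ := lt_mul_iff.1 (hβc.trans_lt hc)
    rcases eq_or_ne y 0 with rfl | hy0
    · have hζ : ζ ≠ 0 := by
        rintro rfl
        simp at hβ
      rw [add_zero, hcof ζ hζ, mul_mod]
      exact hp
    · have hy0 := pos_iff_ne_zero.2 hy0
      rw [cofinalSet_shift _ _ hy0]
      simp only [hval ζ y hy]
      rw [cofinalSet_congr (r' := r) hy0 fun z _ hz => hval ζ z (hz.trans hy)]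
      refine (h y hy).lim y hy0 le_rfl ?_
      rcases isSuccLimit_add_iff.1 hlim with h | h
      · exact h
      · exact absurd h.1 hy0.ne'
  · rw [← hV]
    ext q
    constructor
    · rintro ⟨x, _, rfl⟩
      exact ⟨_, mod_lt _ hl0.ne', rfl⟩
    · rintro ⟨y, hy, rfl⟩
      refine ⟨y, lt_of_lt_of_le hy (le_mul_left l (pos_iff_ne_zero.2 hγ)), ?_⟩
      simp only [mod_eq_of_lt (show y < l from hy)]

end Blank

/-! ### Countable cofinality and powers of ω -/

section Ladders

/-- Some sequence of ordinals below `l` is cofinal in `l`. -/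
def CofOmega (l : Ordinal.{u}) : Prop :=
  ∃ f : ℕ → Ordinal.{u}, (∀ k, f k < l) ∧ ∀ x < l, ∃ k, x ≤ f k

variable {l a x β : Ordinal.{u}}

theorem CofOmega.add (h : CofOmega l) : CofOmega (a + l) := by
  obtain ⟨f, hf, h⟩ := h
  refine ⟨fun k => a + f k, fun k => by simpa using hf k, fun x hx => ?_⟩
  rcases lt_or_ge x a with hxa | hxa
  · by_cases hl : 0 < l
    · obtain ⟨k, _⟩ := h 0 hl
      exact ⟨k, hxa.le.trans le_self_add⟩
    · exact absurd (hf 0) (by simp_all)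
  · obtain ⟨y, rfl⟩ := exists_add_of_le hxa
    obtain ⟨k, hk⟩ := h y (by simpa using hx)
    exact ⟨k, by simpa using hk⟩

theorem CofOmega.of_add (h : CofOmega (a + l)) (hl : l ≠ 0) : CofOmega l := by
  obtain ⟨f, hf, h⟩ := h
  have hl := pos_iff_ne_zero.2 hl
  refine ⟨fun k => f k - a, fun k => sub_lt_of_lt_add (hf k) hl, fun x hx => ?_⟩
  obtain ⟨k, hk⟩ := h (a + x) (by simpa using hx)
  exact ⟨k, le_sub_of_add_le hk⟩

theorem cofOmega_add_iff (hl : l ≠ 0) : CofOmega (a + l) ↔ CofOmega l :=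
  ⟨fun h => h.of_add hl, CofOmega.add⟩

theorem isLadder_mul_omega0 (hl : 0 < l) : IsLadder (fun k : ℕ => l * k) (l * ω) where
  strictMono := fun i j h => by
    simpa [mul_lt_mul_iff_right₀ hl] using h
  zero := by simp
  lt k := by simp [mul_lt_mul_iff_right₀ hl]
  exists_lt x hx := by
    obtain ⟨c, hc, hx⟩ := (lt_mul_iff_of_isSuccLimit isSuccLimit_omega0).1 hx
    obtain ⟨k, rfl⟩ := lt_omega0.1 hc
    exact ⟨k, hx⟩

theorem IsLadder.cofOmega {s : ℕ → Ordinal.{u}} (hs : IsLadder s l) : CofOmega l :=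
  ⟨s, hs.lt, fun x hx => (hs.exists_lt x hx).imp fun _ h => h.le⟩

theorem IsLadder.mul {s : ℕ → Ordinal.{u}} (hs : IsLadder s l) (hl : IsSuccLimit l) (ha : 0 < a) :
    IsLadder (fun k => a * s k) (a * l) where
  strictMono := fun i j h => by simpa [mul_lt_mul_iff_right₀ ha] using hs.strictMono h
  zero := by simp [hs.zero]
  lt k := by simpa [mul_lt_mul_iff_right₀ ha] using hs.lt k
  exists_lt x hx := by
    obtain ⟨c, hc, hx⟩ := (lt_mul_iff_of_isSuccLimit hl).1 hx
    obtain ⟨k, hk⟩ := hs.exists_lt c hc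
    exact ⟨k, hx.trans ((mul_lt_mul_iff_right₀ ha).2 hk)⟩

theorem CofOmega.of_mul (h : CofOmega (a * l)) (ha : a ≠ 0) : CofOmega l := by
  obtain ⟨f, hf, h⟩ := h
  refine ⟨fun k => f k / a, fun k => (lt_mul_iff_div_lt ha).1 (hf k), fun x hx => ?_⟩
  obtain ⟨k, hk⟩ := h (a * x) (by simpa [mul_lt_mul_iff_right₀ (pos_iff_ne_zero.2 ha)] using hx)
  exact ⟨k, (mul_le_iff_le_div ha).1 hk⟩

/-- Successor values are arranged so that, after multiplication by a positive power of ω, all steps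
of the ladder have countable cofinality, as `Approach.mul_of_cofOmega` requires. -/
theorem CofOmega.exists_ladder (h : CofOmega l) (hl : IsSuccLimit l) :
    ∃ s, IsLadder s l ∧ ∀ k, ∃ a, s (k + 1) = a + 1 := by
  obtain ⟨f, hf, h⟩ := h
  let s : ℕ → Ordinal.{u} := fun k => Nat.rec 0 (fun k x => max x (f k) + 1) k
  have hs : ∀ k, s (k + 1) = max (s k) (f k) + 1 := fun _ => rfl
  refine ⟨s, ⟨strictMono_nat_of_lt_succ fun k => ?_, rfl, fun k => ?_, fun x hx => ?_⟩,
    fun k => ⟨_, hs k⟩⟩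
  · rw [hs, lt_add_one_iff]
    exact le_max_left _ _
  · induction k with
    | zero => exact hl.bot_lt
    | succ k ih => exact hl.add_one_lt (max_lt ih (hf k))
  · obtain ⟨k, hk⟩ := h x hx
    refine ⟨k + 1, ?_⟩
    rw [hs, lt_add_one_iff]
    exact hk.trans (le_max_right _ _)

theorem omega0_pow_pos (i : ℕ) : (0 : Ordinal.{u}) < ω ^ i :=
  pow_pos omega0_pos i

theorem isSuccLimit_omega0_pow_mul {i : ℕ} (hi : i ≠ 0) (hβ : β ≠ 0) :
    IsSuccLimit (ω ^ i * β) := by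
  refine isSuccLimit_mul_left ?_ (pos_iff_ne_zero.2 hβ)
  obtain ⟨i, rfl⟩ := Nat.exists_eq_succ_of_ne_zero hi
  rw [pow_succ]
  exact isSuccLimit_mul_right (omega0_pow_pos i) isSuccLimit_omega0

theorem isSuccLimit_omega0_pow {i : ℕ} (hi : i ≠ 0) : IsSuccLimit ((ω : Ordinal.{u}) ^ i) := by
  simpa using isSuccLimit_omega0_pow_mul hi one_ne_zero

theorem add_omega0_pow_mul {i : ℕ} (h : x < ω ^ i) (hβ : β ≠ 0) : x + ω ^ i * β = ω ^ i * β := by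
  rw [← opow_natCast] at *
  exact add_of_omega0_opow_le h (le_mul_left _ (pos_iff_ne_zero.2 hβ))

theorem omega0_pow_mul_add {i : ℕ} (x : Ordinal.{u}) (hβ : β ≠ 0) (hx : x < ω) :
    ω ^ i * x + ω ^ (i + 1) * β = ω ^ (i + 1) * β := by
  refine add_omega0_pow_mul ?_ hβ
  rw [pow_succ]
  exact (mul_lt_mul_iff_right₀ (omega0_pow_pos i)).2 hx

theorem cofOmega_omega0_pow_mul_add_one {i : ℕ} (hi : i ≠ 0) : CofOmega (ω ^ i * (β + 1)) := by
  obtain ⟨i, rfl⟩ := Nat.exists_eq_succ_of_ne_zero hi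
  rw [mul_add_one, pow_succ ω i]
  exact (isLadder_mul_omega0 (omega0_pow_pos i)).cofOmega.add

end Ladders

/-! ### Shortening and lengthening blank words -/

section Blank

variable {Q : Type w} {S : Type v}
variable {A : OrdinalAutomaton Q S} {b : S} {l : Ordinal.{u}} {q q' : Q} {V P : Set Q}

/-- For changing the lengths of all blocks from the `c`-th on while keeping their states and value
sets: values and limit set of the whole are read off from the `W k` alone. -/
theorem Approach.of_blocks {p : ℕ → Q} {W : ℕ → Set Q} {c : ℕ} {s : ℕ → Ordinal.{u}}
    {l' : Ordinal.{u}} (h1 : ∀ k, Traverse A b l (p k) (W k) (p (k + 1))) (hs : IsLadder s l')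
    (h2 : ∀ k, Traverse A b (s (k + 1) - s k) (p (c + k)) (W (c + k)) (p (c + (k + 1)))) :
    Approach A b (l * c + l') (p 0) (⋃ k, W k) {q | ∀ n, ∃ k ≥ n, q ∈ W k} := by
  have := (Traverse.mul_nat h1 c).addApproach (Approach.of_ladder hs h2)
    (hs.zero ▸ hs.lt 0)
  convert this using 1
  · ext x
    simp only [Set.mem_iUnion, Set.mem_union]
    constructor
    · rintro ⟨k, hk⟩
      rcases lt_or_ge k c with h | h
      · exact Or.inl ⟨k, h, hk⟩
      · exact Or.inr ⟨k - c, by rwa [Nat.add_sub_cancel' h]⟩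
    · rintro (⟨k, _, hk⟩ | ⟨k, hk⟩)
      exacts [⟨_, hk⟩, ⟨_, hk⟩]
  · ext x
    simp only [Set.mem_ofPred_eq]
    constructor
    · intro h n
      obtain ⟨k, hk, hx⟩ := h (c + n)
      exact ⟨k - c, by omega, by rwa [Nat.add_sub_cancel' (by omega)]⟩
    · intro h n
      obtain ⟨k, hk, hx⟩ := h n
      exact ⟨c + k, by omega, hx⟩

variable [Finite Q]

theorem exists_forall_subset_limsup (W : ℕ → Set Q) :
    ∃ c, ∀ k ≥ c, W k ⊆ {q | ∀ n, ∃ k ≥ n, q ∈ W k} := by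
  have h : ∀ q, ∃ n, (∃ n, ∀ k ≥ n, q ∉ W k) → ∀ k ≥ n, q ∉ W k := by
    intro q
    by_cases h : ∃ n, ∀ k ≥ n, q ∉ W k
    · exact h.imp fun n hn _ => hn
    · exact ⟨0, fun h' => absurd h' h⟩
  choose f hf using h
  by_cases hQ : Nonempty Q
  · obtain ⟨q₀, h₀⟩ := Finite.exists_max f
    refine ⟨f q₀, fun k hk q hq => ?_⟩
    by_contra hc
    simp only [Set.mem_ofPred_eq, not_forall, not_exists, not_and] at hc
    exact hf q hc k ((h₀ q).trans hk) hq
  · exact ⟨0, fun k _ q => absurd ⟨q⟩ hQ⟩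

theorem Approach.blocks (h : Approach A b (l * ω) q V P) (hl : IsSuccLimit l) :
    ∃ (p : ℕ → Q) (W R : ℕ → Set Q) (c : ℕ), p 0 = q ∧ V = ⋃ k, W k ∧
      P = {q | ∀ n, ∃ k ≥ n, q ∈ W k} ∧ (∀ k, Traverse A b l (p k) (W k) (p (k + 1))) ∧
      (∀ k, Approach A b l (p k) (W k) (R k)) ∧ (∀ k, (R k, p (k + 1)) ∈ A.limTrans) ∧
      (∀ k, R k ⊆ W k) ∧ ∀ k ≥ c, W k ⊆ P := by
  obtain ⟨p, W, hp, hV, hP, h⟩ := h.ladder (isLadder_mul_omega0 hl.bot_lt)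
  have h : ∀ k, Traverse A b l (p k) (W k) (p (k + 1)) := fun k => by
    have := h k
    rwa [Nat.cast_succ, mul_add_one, Ordinal.add_sub_cancel] at this
  choose R hR hR' using fun k => (h k).approach hl
  obtain ⟨c, hc⟩ := exists_forall_subset_limsup W
  exact ⟨p, W, R, c, hp, hV, hP, h, hR, hR', fun k => (hR k).subset hl.bot_lt, hP ▸ hc⟩

theorem ncard_le_of_ssubset {R : Set Q} {i : ℕ} (h : R ⊆ P) (hne : R ≠ P) (hP : P.ncard ≤ i + 1) :
    R.ncard ≤ i := by
  have := Set.ncard_lt_ncard (h.ssubset_of_ne hne) (Set.toFinite P)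
  omega

/-- Induction on the size of the limit set `P`. A late block whose own limit set is `P` lets the run
stop at its end; otherwise all late blocks have strictly smaller limit sets and shrink by induction.
-/
theorem Approach.exists_shorter (i : ℕ) : ∀ {q : Q} {V P : Set Q}, P.ncard ≤ i →
    Approach A b ((ω : Ordinal.{u}) ^ (i + 1)) q V P →
    ∃ c : ℕ, c ≠ 0 ∧ Approach A b ((ω : Ordinal.{u}) ^ i * c) q V P := by
  induction i with
  | zero =>
    intro q V P hP h
    have := h.nonempty (isSuccLimit_omega0_pow (by omega))
    rw [← Set.ncard_pos] at this
    omega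
  | succ i ih =>
    intro q V P hP h
    have hl : IsSuccLimit ((ω : Ordinal.{u}) ^ (i + 1)) := isSuccLimit_omega0_pow (by omega)
    rw [pow_succ ω (i + 1)] at h
    obtain ⟨p, W, R, c, rfl, rfl, hP', hW, hR, hlim, hRW, hc⟩ := h.blocks hl
    by_cases hk : ∃ k ≥ c, R k = P
    · obtain ⟨k, hk, hkP⟩ := hk
      refine ⟨k + 1, by omega, ?_⟩
      have := (Traverse.mul_nat hW k).addApproach (hR k) hl.bot_lt
      rw [hkP] at this
      rw [Nat.cast_succ, mul_add_one]
      convert this using 1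
      apply Set.Subset.antisymm
      · refine Set.iUnion_subset fun j => ?_
        rcases lt_or_ge j k with hj | hj
        · exact (Set.subset_iUnion₂ (s := fun k (_ : k < _) => W k) j hj).trans Set.subset_union_left
        · exact ((hc j (hk.trans hj)).trans (hkP ▸ hRW k)).trans Set.subset_union_right
      · exact Set.union_subset (Set.iUnion₂_subset fun j _ => Set.subset_iUnion W j)
          (Set.subset_iUnion W k)
    · push Not at hk
      have hcard : ∀ k, (R (c + k)).ncard ≤ i := fun k =>
        ncard_le_of_ssubset ((hRW _).trans (hc _ (by omega))) (hk _ (by omega)) hP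
      have hi : i ≠ 0 := by
        have h1 := (hR (c + 0)).nonempty hl
        rw [← Set.ncard_pos] at h1
        have := hcard 0
        omega
      choose C hC0 hC using fun k => ih (hcard k) (hR (c + k))
      have hs : IsLadder (fun k => (ω : Ordinal.{u}) ^ i * ((∑ j ∈ Finset.range k, C j : ℕ) : Ordinal))
          (ω ^ i * ω) := by
        have hmono : StrictMono fun k => ∑ j ∈ Finset.range k, C j :=
          strictMono_nat_of_lt_succ fun k => by
            rw [Finset.sum_range_succ]
            have := hC0 k
            omega
        refine IsLadder.mul ⟨fun i j h => Nat.cast_lt.2 (hmono h), by simp,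
          fun k => natCast_lt_omega0 _, fun x hx => ?_⟩ isSuccLimit_omega0 (omega0_pow_pos i)
        obtain ⟨n, rfl⟩ := lt_omega0.1 hx
        exact ⟨n + 1, Nat.cast_lt.2 ((Nat.lt_succ_self n).trans_le (hmono.id_le (n + 1)))⟩
      -- The tail blocks, of length ω^i times a nonzero integer each, add up to ω^i · ω = ω^(i+1),
      -- one more block after the first `c`.
      refine ⟨c + 1, by omega, ?_⟩
      have := Approach.of_blocks (c := c) hW hs fun k => by
        rw [Finset.sum_range_succ, Nat.cast_add, mul_add, Ordinal.add_sub_cancel]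
        exact (hC k).traverse (isSuccLimit_omega0_pow_mul hi (by simpa using hC0 k)) (hlim _)
      rwa [← hP', ← pow_succ, ← mul_add_one, ← Nat.cast_succ] at this

theorem Approach.exists_shorter' {i : ℕ} (hi : Nat.card Q ≤ i)
    (h : Approach A b ((ω : Ordinal.{u}) ^ (i + 1)) q V P) :
    ∃ c : ℕ, c ≠ 0 ∧ Approach A b ((ω : Ordinal.{u}) ^ i * c) q V P :=
  h.exists_shorter i ((Set.ncard_le_card P).trans hi)

/-- Everything before the last block shrinks to a finite multiple of ω^i, which the last block
ω^(i+1) absorbs on its left. -/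
theorem Approach.of_mul_nat {i : ℕ} (hi : Nat.card Q ≤ i) {c : ℕ} (hc : c ≠ 0) :
    ∀ {q : Q} {V P : Set Q}, Approach A b ((ω : Ordinal.{u}) ^ (i + 1) * c) q V P →
    Approach A b ((ω : Ordinal.{u}) ^ (i + 1)) q V P := by
  induction c with
  | zero => exact absurd rfl hc
  | succ c ih =>
    intro q V P h
    rcases eq_or_ne c 0 with rfl | hc
    · simpa using h
    have hi0 : i ≠ 0 := by
      have : Nonempty Q := ⟨q⟩
      have := Nat.card_pos (α := Q)
      omega
    have hc' : (c : Ordinal.{u}) ≠ 0 := by simpa using hc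
    rw [Nat.cast_succ, mul_add_one] at h
    obtain ⟨V₁, V₂, p, rfl, h1, h2⟩ := h.split (omega0_pow_pos _)
    obtain ⟨P₁, h1, hp⟩ := h1.approach (isSuccLimit_omega0_pow_mul (by omega) hc')
    obtain ⟨d, hd, h1⟩ := (ih hc h1).exists_shorter' hi
    have := (h1.traverse (isSuccLimit_omega0_pow_mul hi0 (by simpa using hd)) hp).addApproach h2
      (omega0_pow_pos _)
    have h3 := omega0_pow_mul_add (i := i) (d : Ordinal.{u}) one_ne_zero (natCast_lt_omega0 d)
    rw [mul_one] at h3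
    rwa [h3] at this

theorem Approach.of_pow_succ {i : ℕ} (hi : Nat.card Q ≤ i)
    (h : Approach A b ((ω : Ordinal.{u}) ^ (i + 2)) q V P) :
    Approach A b ((ω : Ordinal.{u}) ^ (i + 1)) q V P := by
  obtain ⟨c, hc, h⟩ := h.exists_shorter' (i := i + 1) (by omega)
  exact h.of_mul_nat hi hc

/-- Closing off: past some point only states of the limit set `P` occur, and each step of an
ω-sequence is chosen so long that all of `P` occurs in it. Without countable cofinality the supremum
of the sequence stays below `β`, and its limit set is `P` too. -/
theorem exists_cofinalSet_eq {m : ℕ} (hm : m ≠ 0) {β : Ordinal.{u}} (hβ : β ≠ 0)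
    (hcof : ¬ CofOmega (ω ^ m * β)) (r : Ordinal.{u} → Q) : ∃ δ₁ < β, ∀ δ₀, δ₁ ≤ δ₀ → δ₀ < β →
      ∃ δ, δ₀ < δ ∧ δ < β ∧ cofinalSet r (ω ^ m * δ) = cofinalSet r (ω ^ m * β) ∧
        r '' Set.Ico (ω ^ m * δ₀) (ω ^ m * δ) = cofinalSet r (ω ^ m * β) ∧
        r '' Set.Iio (ω ^ m * δ) = r '' Set.Iio (ω ^ m * β) := by
  set P := cofinalSet r (ω ^ m * β) with hP
  have hlim : IsSuccLimit β := by
    rcases zero_or_succ_or_isSuccLimit β with h | ⟨β', rfl⟩ | h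
    · exact absurd h hβ
    · exact absurd (cofOmega_omega0_pow_mul_add_one hm) hcof
    · exact h
  have hpos := omega0_pow_pos.{u} m
  obtain ⟨a, ha, haP⟩ := exists_image_subset_cofinalSet r (isSuccLimit_omega0_pow_mul hm hβ)
  have hsub : ∀ x y, a ≤ x → y ≤ ω ^ m * β → r '' Set.Ico x y ⊆ P := fun x y hx hy =>
    (Set.image_mono (Set.Ico_subset_Ico hx hy)).trans haP
  obtain ⟨δ₁, hδ₁, haδ⟩ := (lt_mul_iff_of_isSuccLimit hlim).1 ha
  have hmul : ∀ {x y : Ordinal.{u}}, x < y → (ω ^ m * x : Ordinal.{u}) < ω ^ m * y := fun h =>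
    (mul_lt_mul_iff_right₀ hpos).2 h
  have hmul' : ∀ {x y : Ordinal.{u}}, x ≤ y → (ω ^ m * x : Ordinal.{u}) ≤ ω ^ m * y := fun h =>
    (mul_le_mul_iff_right₀ hpos).2 h
  have hstep : ∀ δ : Set.Iio β, ∃ δ' : Set.Iio β, δ < δ' ∧
      P ⊆ r '' Set.Ioo (ω ^ m * δ) (ω ^ m * δ') := by
    rintro ⟨δ, hδ⟩
    have : ∀ q : Q, ∃ δ' < β, q ∈ P → ∃ z, ω ^ m * δ < z ∧ z < ω ^ m * δ' ∧ r z = q := by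
      intro q
      by_cases hq : q ∈ P
      · obtain ⟨z, hz, hzβ, hzq⟩ := hq _ (hmul hδ)
        obtain ⟨δ', hδ', hz'⟩ := (lt_mul_iff_of_isSuccLimit hlim).1 hzβ
        exact ⟨δ', hδ', fun _ => ⟨z, hz, hz', hzq⟩⟩
      · exact ⟨0, hlim.bot_lt, fun h => absurd h hq⟩
    choose f hf hf' using this
    have : Nonempty Q := ⟨r 0⟩
    obtain ⟨q₀, hq₀⟩ := Finite.exists_max f
    refine ⟨⟨max (f q₀) (δ + 1), max_lt (hf q₀) (hlim.add_one_lt hδ)⟩, ?_, fun q hq => ?_⟩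
    · exact (lt_add_one δ).trans_le (le_max_right _ _)
    · obtain ⟨z, h1, h2, h3⟩ := hf' q hq
      exact ⟨z, ⟨h1, h2.trans_le (hmul' ((hq₀ q).trans (le_max_left _ _)))⟩, h3⟩
  choose g hg hgP using hstep
  refine ⟨δ₁, hδ₁, fun δ₀ h₁ h₀ => ?_⟩
  let s : ℕ → Set.Iio β := fun k => Nat.rec ⟨δ₀, h₀⟩ (fun _ x => g x) k
  have hs : StrictMono s := strictMono_nat_of_lt_succ fun k => hg (s k)
  have hsP : ∀ k : ℕ, P ⊆ r '' Set.Ioo (ω ^ m * (s k).1) (ω ^ m * (s (k + 1)).1) :=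
    fun k => hgP (s k)
  -- An unbounded sequence would witness the countable cofinality excluded by `hcof`.
  obtain ⟨x, hx, hxs⟩ : ∃ x < β, ∀ k, (s k).1 ≤ x := by
    by_contra! hc
    refine hcof ⟨fun k => ω ^ m * (s k).1, fun k => hmul (s k).2, fun x hx => ?_⟩
    obtain ⟨c, hc', hx⟩ := (lt_mul_iff_of_isSuccLimit hlim).1 hx
    obtain ⟨k, hk⟩ := hc c hc'
    exact ⟨k, hx.le.trans (hmul' hk.le)⟩
  let δ := sInf {x : Ordinal.{u} | ∀ k, (s k).1 ≤ x}
  have hδs : ∀ k, (s k).1 ≤ δ := csInf_mem (s := {x | ∀ k, (s k).1 ≤ x}) ⟨x, hxs⟩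
  have hδs' : ∀ k, (s k).1 < δ := fun k =>
    lt_of_lt_of_le (hs (Nat.lt_succ_self k)) (hδs (k + 1))
  have hδβ : δ < β := (csInf_le' (s := {x | ∀ k, (s k).1 ≤ x}) hxs).trans_lt hx
  have hex : ∀ y < δ, ∃ k, y < (s k).1 := by
    intro y hy
    by_contra! hc
    exact (csInf_le' (s := {x | ∀ k, (s k).1 ≤ x}) hc).not_gt hy
  have hδlim : IsSuccLimit δ := by
    rcases zero_or_succ_or_isSuccLimit δ with h | ⟨y, hy⟩ | h
    · exact absurd (h ▸ hδs' 0) not_lt_zero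
    · obtain ⟨k, hk⟩ := hex y (hy ▸ lt_succ y)
      exact absurd (hδs' k) (not_lt.2 (hy ▸ succ_le_of_lt hk))
    · exact h
  have hPim : P ⊆ r '' Set.Ico (ω ^ m * δ₀) (ω ^ m * δ) := (hsP 0).trans
    (Set.image_mono fun z hz => ⟨hz.1.le, hz.2.trans_le (hmul' (hδs 1))⟩)
  refine ⟨δ, hδs' 0, hδβ, ?_, (hsub _ _ (haδ.le.trans (hmul' h₁)) (hmul' hδβ.le)).antisymm hPim, ?_⟩
  · apply Set.Subset.antisymm
    · exact (cofinalSet_subset_image r (haδ.trans_le (hmul' (h₁.trans (hδs 0))))).trans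
        (hsub _ _ le_rfl (hmul' hδβ.le))
    · intro q hq y hy
      obtain ⟨y', hy', hyy⟩ := (lt_mul_iff_of_isSuccLimit hδlim).1 hy
      obtain ⟨k, hk⟩ := hex y' hy'
      obtain ⟨z, hz, rfl⟩ := hsP k hq
      exact ⟨z, hyy.trans ((hmul hk).trans hz.1), hz.2.trans (hmul (hδs' (k + 1))), rfl⟩
  · apply Set.Subset.antisymm (Set.image_mono (Set.Iio_subset_Iio (hmul' hδβ.le)))
    rintro _ ⟨z, hz, rfl⟩
    rcases lt_or_ge z (ω ^ m * δ) with h | h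
    · exact ⟨z, h, rfl⟩
    · have h1 : a ≤ z := haδ.le.trans ((hmul' (h₁.trans (hδs 0))).trans h)
      obtain ⟨y, hy, hy'⟩ := hPim (hsub _ _ le_rfl le_rfl ⟨z, ⟨h1, hz⟩, rfl⟩)
      exact ⟨y, hy.2, hy'⟩

/-- Transfinite induction on `β`. A successor reduces to two blocks. In countable cofinality every
ladder step becomes one block, giving ω^(i+2), which shrinks again. In uncountable cofinality the
run is cut at an earlier point with the same limit set. -/
theorem Approach.of_mul {i : ℕ} (hi : Nat.card Q ≤ i) (β : Ordinal.{u}) :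
    ∀ {q : Q} {V P : Set Q}, β ≠ 0 → Approach A b ((ω : Ordinal.{u}) ^ (i + 1) * β) q V P →
    Approach A b ((ω : Ordinal.{u}) ^ (i + 1)) q V P := by
  induction β using WellFoundedLT.induction with
  | ind β ih =>
  intro q V P hβ h
  have hlim : ∀ γ : Ordinal.{u}, γ ≠ 0 → IsSuccLimit (ω ^ (i + 1) * γ) := fun γ =>
    isSuccLimit_omega0_pow_mul (by omega)
  rcases zero_or_succ_or_isSuccLimit β with h' | ⟨γ, rfl⟩ | hl
  · exact absurd h' hβ
  · rcases eq_or_ne γ 0 with rfl | hγ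
    · simpa using h
    rw [mul_succ] at h
    obtain ⟨V₁, V₂, p, rfl, h1, h2⟩ := h.split (omega0_pow_pos _)
    obtain ⟨P₁, h1, hp⟩ := h1.approach (hlim γ hγ)
    have h3 := ((ih γ (lt_succ γ) hγ h1).traverse (isSuccLimit_omega0_pow (by omega)) hp).addApproach
      h2 (omega0_pow_pos _)
    refine Approach.of_mul_nat (c := 2) hi (by omega) ?_
    rwa [Nat.cast_ofNat, Ordinal.mul_two]
  · by_cases hcof : CofOmega ((ω : Ordinal.{u}) ^ (i + 1) * β)
    · obtain ⟨s, hs, _⟩ := (hcof.of_mul (omega0_pow_pos _).ne').exists_ladder hl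
      obtain ⟨p, W, rfl, rfl, rfl, hW⟩ := h.ladder (hs.mul hl (omega0_pow_pos (i + 1)))
      apply Approach.of_pow_succ hi
      rw [pow_succ ω (i + 1)]
      refine Approach.of_ladder (isLadder_mul_omega0 (omega0_pow_pos (i + 1))) fun k => ?_
      rw [Nat.cast_succ, mul_add_one, Ordinal.add_sub_cancel]
      have hk := hW k
      rw [← Ordinal.mul_sub] at hk
      have hne : s (k + 1) - s k ≠ 0 :=
        Ordinal.sub_ne_zero_iff_lt.2 (hs.strictMono (Nat.lt_succ_self k))
      obtain ⟨P₁, h1, hp⟩ := hk.approach (hlim _ hne)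
      exact (ih _ ((sub_le_self _ _).trans_lt (hs.lt _)) hne h1).traverse
        (isSuccLimit_omega0_pow (by omega)) hp
    · obtain ⟨r, h, rfl, rfl, rfl⟩ := h
      obtain ⟨δ₁, hδ₁, H⟩ := exists_cofinalSet_eq (by omega) hβ hcof r
      obtain ⟨δ, hδ, hδβ, h1, _, h2⟩ := H δ₁ le_rfl hδ₁
      refine ih δ hδβ (pos_of_gt hδ).ne' ⟨r, fun c hc => h c (hc.trans ?_), rfl, h2, h1⟩
      exact (mul_lt_mul_iff_right₀ (omega0_pow_pos _)).2 hδβ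

/-- Two closing-off points enclose a stretch that visits exactly `P` and has limit set `P`, and its
initial state may follow `P`. Shrunk to one block, this stretch can be pumped to any number of
copies. -/
theorem Approach.mul_of_not_cofOmega {i : ℕ} (hi : Nat.card Q ≤ i) {β γ : Ordinal.{u}}
    (hβ : β ≠ 0) (hcof : ¬ CofOmega (ω ^ (i + 1) * β)) (hγ : 1 < γ)
    (h : Approach A b ((ω : Ordinal.{u}) ^ (i + 1) * β) q V P) :
    Approach A b ((ω : Ordinal.{u}) ^ (i + 1) * γ) q V P := by
  have hlim : ∀ γ : Ordinal.{u}, γ ≠ 0 → IsSuccLimit (ω ^ (i + 1) * γ) := fun γ =>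
    isSuccLimit_omega0_pow_mul (by omega)
  have hlim' : IsSuccLimit ((ω : Ordinal.{u}) ^ (i + 1)) := isSuccLimit_omega0_pow (by omega)
  obtain ⟨r, h, rfl, rfl, rfl⟩ := h
  obtain ⟨δ₁, hδ₁, H⟩ := exists_cofinalSet_eq (by omega) hβ hcof r
  set P := cofinalSet r (ω ^ (i + 1) * β) with hP
  choose g hg hgβ hg1 hg2 hg3 using H
  let s : ℕ → {δ // δ₁ ≤ δ ∧ δ < β} := fun k =>
    Nat.rec ⟨g δ₁ le_rfl hδ₁, (hg _ _ _).le, hgβ _ _ _⟩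
      (fun _ x => ⟨g x x.2.1 x.2.2, x.2.1.trans (hg _ _ _).le, hgβ _ _ _⟩) k
  have hs : StrictMono fun k : ℕ => (s k).1 :=
    strictMono_nat_of_lt_succ (f := fun k : ℕ => (s k).1)
      fun k => hg (s k).1 (s k).2.1 (s k).2.2
  have hs0 : ∀ k, (s k).1 ≠ 0 := by
    intro k
    have h1 : (s 0).1 ≤ (s k).1 := hs.monotone (Nat.zero_le k)
    have h2 : δ₁ < (s 0).1 := hg _ _ _
    exact (pos_of_gt (h2.trans_le h1)).ne'
  have hs1 : ∀ k, cofinalSet r (ω ^ (i + 1) * (s k).1) = P := by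
    rintro (_ | k)
    · exact hg1 _ _ _
    · exact hg1 _ _ _
  have hs2 : ∀ k, r '' Set.Iio (ω ^ (i + 1) * (s k).1) =
      r '' Set.Iio (ω ^ (i + 1) * β) := by
    rintro (_ | k)
    · exact hg3 _ _ _
    · exact hg3 _ _ _
  obtain ⟨j, k, hjk, hr⟩ : ∃ j k, j < k ∧ r (ω ^ (i + 1) * (s j).1) = r (ω ^ (i + 1) * (s k).1) := by
    obtain ⟨j, k, hne, h⟩ := Finite.exists_ne_map_eq_of_infinite
      fun k => r (ω ^ (i + 1) * (s k).1)
    rcases hne.lt_or_gt with h' | h'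
    exacts [⟨j, k, h', h⟩, ⟨k, j, h', h.symm⟩]
  have hsub : ∀ k, r '' Set.Ico (ω ^ (i + 1) * (s k).1) (ω ^ (i + 1) * (s (k + 1)).1) = P :=
    fun k => hg2 _ _ _
  have hmono : Monotone fun k => (ω ^ (i + 1) * (s k).1 : Ordinal.{u}) := fun j k h =>
    (mul_le_mul_iff_right₀ (omega0_pow_pos _)).2 (hs.monotone h)
  have himage : r '' Set.Ico (ω ^ (i + 1) * (s j).1) (ω ^ (i + 1) * (s k).1) = P := by
    induction k, hjk using Nat.le_induction with
    | base => exact hsub j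
    | succ k hk ih' =>
      have hk' : j < k + 1 := by omega
      rw [← Set.Ico_union_Ico_eq_Ico (hmono (show j ≤ k by omega)) (hmono (Nat.le_succ k)),
        Set.image_union, hsub]
      refine Set.union_eq_right.2 ?_
      clear ih' hr
      induction k, hk using Nat.le_induction with
      | base => exact (hsub j).subset
      | succ k hk ih' =>
        rw [← Set.Ico_union_Ico_eq_Ico (hmono (show j ≤ k by omega)) (hmono (Nat.le_succ k)),
          Set.image_union, hsub]
        exact Set.union_subset (ih' (by omega)) le_rfl
  have hlt : ∀ k, (ω ^ (i + 1) * (s k).1 : Ordinal.{u}) < ω ^ (i + 1) * β := fun k =>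
    (mul_lt_mul_iff_right₀ (omega0_pow_pos _)).2 (s k).2.2
  obtain ⟨η, hη⟩ := exists_add_of_le (hs.monotone hjk.le)
  have hη0 : η ≠ 0 := by
    rintro rfl
    exact (hs hjk).ne (by simpa using hη.symm)
  have hη' : (ω ^ (i + 1) * (s j).1 + ω ^ (i + 1) * η : Ordinal.{u}) = ω ^ (i + 1) * (s k).1 := by
    rw [← mul_add]
    exact congrArg _ hη.symm
  have hrun := h _ (hlt k)
  have hloop := Traverse.of_runOn (a := ω ^ (i + 1) * (s j).1) (l := ω ^ (i + 1) * η)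
    (by rw [hη']; exact hrun.mono zero_le le_rfl)
  rw [hη', himage, ← hr] at hloop
  set p := r (ω ^ (i + 1) * (s j).1) with hp
  have hpP : (P, p) ∈ A.limTrans := by
    have := (h _ (hlt j)).lim _ (hlim _ (hs0 j)).bot_lt le_rfl (hlim _ (hs0 j))
    rwa [hs1] at this
  have hloop' : Approach A b (ω ^ (i + 1) * η) p P P := by
    refine ⟨fun y => r (ω ^ (i + 1) * (s j).1 + y), fun c hc => ?_, by simp [hp], ?_, ?_⟩
    · refine RunOn.unshift (x := fun _ => b) ((h (ω ^ (i + 1) * (s j).1 + c) ?_).mono zero_le le_rfl)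
        fun _ _ => rfl
      refine lt_trans ?_ (hlt k)
      rw [← hη']
      simpa using hc
    · rw [← image_Ico_add, hη', himage]
    · rw [← cofinalSet_shift _ _ (hlim _ hη0).bot_lt, hη', hs1]
  have h1 : Approach A b (ω ^ (i + 1) * (s j).1) (r 0)
      (r '' Set.Iio (ω ^ (i + 1) * β)) P :=
    ⟨r, fun c hc => h c (hc.trans (hlt j)), rfl, hs2 j, hs1 j⟩
  have h2 := (h1.of_mul hi _ (hs0 j)).traverse hlim' hpP
  -- The part before the loop occupies one block, so the loop is repeated `γ - 1` times, and 1 + (γ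
  -- - 1) = γ; this is nonzero because `1 < γ`.
  have h3 := (hloop'.of_mul hi _ hη0).mul hlim' hpP (Ordinal.sub_ne_zero_iff_lt.2 hγ)
  have h4 := h2.addApproach h3 (hlim _ (Ordinal.sub_ne_zero_iff_lt.2 hγ)).bot_lt
  rw [← mul_one_add, Ordinal.add_sub_cancel_of_le hγ.le] at h4
  convert h4 using 1
  rw [Set.union_eq_left.2]
  exact h1.subset (hlim _ (hs0 j)).bot_lt

/-- Induction on the size of `P`, in the manner of `Approach.exists_shorter`: if block limit sets
equal `P` infinitely often, a loop can be pumped; otherwise the late blocks are stretched by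
induction along a ladder of ωβ. -/
theorem Approach.mul_of_cofOmega (i : ℕ) : ∀ {q : Q} {V P : Set Q}, P.ncard ≤ i →
    Approach A b ((ω : Ordinal.{u}) ^ (i + 1)) q V P → ∀ {β : Ordinal.{u}}, β ≠ 0 →
    CofOmega (ω ^ (i + 1) * β) → Approach A b (ω ^ (i + 1) * β) q V P := by
  induction i with
  | zero =>
    intro q V P hP h
    have := h.nonempty (isSuccLimit_omega0_pow (by omega))
    rw [← Set.ncard_pos] at this
    omega
  | succ i ih =>
    intro q V P hP h β hβ hcof
    have hl : IsSuccLimit ((ω : Ordinal.{u}) ^ (i + 1)) := isSuccLimit_omega0_pow (by omega)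
    have hωβ : IsSuccLimit (ω * β) := isSuccLimit_mul_left isSuccLimit_omega0 (pos_iff_ne_zero.2 hβ)
    rw [pow_succ ω (i + 1)] at h
    rw [pow_succ ω (i + 1), mul_assoc] at hcof ⊢
    obtain ⟨p, W, R, c, rfl, rfl, hP', hW, hR, hlim, hRW, hc⟩ := h.blocks hl
    by_cases hinf : ∀ n, ∃ k ≥ n, R k = P
    · obtain ⟨n, hn⟩ := exists_forall_subset_limsup fun k => {x | R k = P ∧ x = p (k + 1)}
      obtain ⟨k₁, hk₁, hRk⟩ := hinf (max n c)
      have hfreq := hn k₁ ((le_max_left _ _).trans hk₁) ⟨hRk, rfl⟩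
      obtain ⟨k₂, hk₂, hRk₂, hpk⟩ := hfreq (k₁ + 1)
      obtain ⟨d, rfl⟩ := Nat.exists_eq_add_of_le hk₂
      have hloop := (Traverse.mul_nat (p := fun k => p (k₁ + 1 + k)) (V := fun k => W (k₁ + 1 + k))
        (fun k => hW (k₁ + 1 + k)) d).addApproach (hR (k₁ + 1 + d)) hl.bot_lt
      rw [← mul_add_one, ← Nat.cast_succ, hRk₂] at hloop
      have hcP : ∀ k, W (k₁ + 1 + k) ⊆ P := fun k =>
        hc _ (((le_max_right n c).trans hk₁).trans (by omega))
      have hPW : P ⊆ W (k₁ + 1 + d) := hRk₂ ▸ hRW _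
      have hun : (⋃ k < d, W (k₁ + 1 + k)) ∪ W (k₁ + 1 + d) = P :=
        (Set.union_subset (Set.iUnion₂_subset fun k _ => hcP k) (hcP d)).antisymm
          (hPW.trans Set.subset_union_right)
      simp only [add_zero] at hloop
      rw [hun] at hloop
      -- Block `k₁` has limit set `P` and is followed by this state, so the loop may restart after
      -- each copy.
      have hPp : (P, p (k₁ + 1)) ∈ A.limTrans := hRk ▸ hlim k₁
      have hd : ((d + 1 : ℕ) : Ordinal.{u}) ≠ 0 := by simp
      have hloop' := hloop.mul (isSuccLimit_omega0_pow_mul (by omega) hd) hPp hωβ.ne_bot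
      have h3 := (Traverse.mul_nat hW (k₁ + 1)).addApproach hloop'
        (mul_pos (isSuccLimit_omega0_pow_mul (by omega) hd).bot_lt hωβ.bot_lt)
      -- The finite factor `d + 1` and the `k₁ + 1` initial blocks are both absorbed by ωβ.
      rw [mul_assoc, ← mul_add, ← mul_assoc _ ω, natCast_mul_omega0 (by omega),
        natCast_add_of_omega0_le (omega0_le_of_isSuccLimit hωβ)] at h3
      convert h3 using 1
      apply Set.Subset.antisymm
      · refine Set.iUnion_subset fun j => ?_
        rcases lt_or_ge j (k₁ + 1) with hj | hj
        · exact (Set.subset_iUnion₂ (s := fun k (_ : k < _) => W k) j hj).trans Set.subset_union_left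
        · obtain ⟨j, rfl⟩ := Nat.exists_eq_add_of_le hj
          exact (hcP j).trans Set.subset_union_right
      · exact Set.union_subset (Set.iUnion₂_subset fun j _ => Set.subset_iUnion W j)
          (hPW.trans (Set.subset_iUnion W _))
    · push Not at hinf
      obtain ⟨n, hn⟩ := hinf
      set c' := max n c
      have hcard : ∀ k, (R (c' + k)).ncard ≤ i := fun k =>
        ncard_le_of_ssubset ((hRW _).trans (hc _ ((le_max_right n c).trans (by omega))))
          (hn _ ((le_max_left n c).trans (by omega))) hP
      obtain ⟨t, ht, ht1⟩ := (hcof.of_mul (omega0_pow_pos _).ne').exists_ladder hωβ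
      have := Approach.of_blocks (c := c') hW (ht.mul hωβ (omega0_pow_pos (i + 1))) fun k => by
        rw [← Ordinal.mul_sub]
        have hlt := ht.strictMono (Nat.lt_succ_self k)
        have hne : t (k + 1) - t k ≠ 0 := Ordinal.sub_ne_zero_iff_lt.2 hlt
        refine (ih (hcard k) (hR _) hne ?_).traverse
          (isSuccLimit_omega0_pow_mul (by omega) hne) (hlim _)
        obtain ⟨a, ha⟩ := ht1 k
        have heq := Ordinal.add_sub_cancel_of_le hlt.le
        have : CofOmega (ω ^ (i + 1) * (t k + (t (k + 1) - t k))) := by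
          rw [show t k + (t (k + 1) - t k) = a + 1 from heq.trans ha]
          exact cofOmega_omega0_pow_mul_add_one (by omega)
        rw [mul_add] at this
        exact this.of_add (mul_ne_zero (omega0_pow_pos _).ne' hne)
      rwa [← hP', ← mul_assoc, ← pow_succ, omega0_pow_mul_add _ hβ (natCast_lt_omega0 _), pow_succ,
        mul_assoc] at this

end Blank

/-! ### The finite monoid of relations on states -/

section StateRel

variable {Q : Type w}

/-- Binary relations on the set of states. -/
def StateRel (Q : Type w) : Type w := Set (Q × Q)

instance [Finite Q] : Finite (StateRel Q) := inferInstanceAs (Finite (Set (Q × Q)))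

/-- The multiplication of `StateRel Q` is the composition of relations. -/
instance : Monoid (StateRel Q) where
  one := {x | x.1 = x.2}
  mul R T := {x | ∃ p, (x.1, p) ∈ (show Set (Q × Q) from R) ∧ (p, x.2) ∈ (show Set (Q × Q) from T)}
  mul_assoc R T W := by
    refine Set.ext fun x => ⟨?_, ?_⟩
    · rintro ⟨p, ⟨p', h1, h2⟩, h3⟩
      exact ⟨p', h1, p, h2, h3⟩
    · rintro ⟨p, h1, p', h2, h3⟩
      exact ⟨p', ⟨p, h1, h2⟩, h3⟩
  one_mul R := by
    refine Set.ext fun ⟨x, y⟩ => ⟨?_, fun h => ⟨x, rfl, h⟩⟩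
    rintro ⟨p, h1, h2⟩
    cases (show x = p from h1)
    exact h2
  mul_one R := by
    refine Set.ext fun ⟨x, y⟩ => ⟨?_, fun h => ⟨y, h, rfl⟩⟩
    rintro ⟨p, h1, h2⟩
    cases (show p = y from h2)
    exact h1

/-- A product in a finite monoid is the product of a short subsequence of its factors. -/
theorem exists_short_sublist_prod_eq {M : Type*} [Monoid M] [Finite M] (L : List M) :
    ∃ L' : List M, L'.Sublist L ∧ L'.prod = L.prod ∧ L'.length < Nat.card M := by
  induction hn : L.length using Nat.strong_induction_on generalizing L with
  | h n ih =>
  by_cases hlt : L.length < Nat.card M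
  · exact ⟨L, List.Sublist.refl L, rfl, hlt⟩
  -- There are more prefixes than monoid elements, so two prefixes have equal products and the
  -- factors between them can be dropped.
  obtain ⟨i, j, hij, h⟩ : ∃ i j : Fin (L.length + 1), i < j ∧
      (L.take i).prod = (L.take j).prod := by
    by_contra! hc
    have hinj : Function.Injective fun i : Fin (L.length + 1) => (L.take i).prod := by
      intro i j h
      by_contra hne
      rcases lt_or_gt_of_ne hne with h' | h'
      exacts [hc i j h' h, hc j i h' h.symm]
    have := Nat.card_le_card_of_injective _ hinj
    simp at this
    omega
  have hi : (i : ℕ) < j := hij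
  have hsub : (L.take i ++ L.drop j).Sublist L := by
    conv_rhs => rw [← List.take_append_drop i L]
    exact (List.Sublist.refl _).append (List.drop_sublist_drop_left L hi.le)
  have hprod : (L.take i ++ L.drop j).prod = L.prod := by
    rw [List.prod_append, h, ← List.prod_append, List.take_append_drop]
  obtain ⟨L', h1, h2, h3⟩ := ih (L.take i ++ L.drop j).length
    (by simp only [List.length_append, List.length_take, List.length_drop]; omega) _ rfl
  exact ⟨L', h1.trans hsub, h2.trans hprod, h3⟩

end StateRel

/-! ### Types of words and the words realizing a given type -/

section WordType

variable {Q : Type w} {S : Type v} {ι : Type*}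

/-- The pairs of states joined by a run of `A` on the letters of `x` at the positions `β` with
`a ≤ β < b`. -/
def runRel (A : OrdinalAutomaton Q S) (x : Ordinal.{u} → S) (a b : Ordinal.{u}) : StateRel Q :=
  {z : Q × Q | ∃ r, RunOn A x a b r ∧ r a = z.1 ∧ r b = z.2}

theorem runRel_mul (A : OrdinalAutomaton Q S) (x : Ordinal.{u} → S) {a b c : Ordinal.{u}}
    (hab : a ≤ b) (hbc : b ≤ c) : runRel A x a b * runRel A x b c = runRel A x a c := by
  refine Set.ext fun ⟨p, q⟩ => ⟨?_, ?_⟩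
  · rintro ⟨p', ⟨r, hr, rfl, rfl⟩, ⟨r', hr', h, rfl⟩⟩
    refine ⟨_, hr.glue hr' h.symm, ?_, ?_⟩
    · rcases hab.lt_or_eq with h' | rfl
      · simp [h']
      · simpa using h
    · simp [hbc.not_gt]
  · rintro ⟨r, hr, rfl, rfl⟩
    exact ⟨r b, ⟨r, hr.mono le_rfl hbc, rfl, rfl⟩, ⟨r, hr.mono hab le_rfl, rfl, rfl⟩⟩

theorem runRel_self (A : OrdinalAutomaton Q S) (x : Ordinal.{u} → S) (a : Ordinal.{u}) :
    runRel A x a a = 1 := by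
  refine Set.ext fun ⟨p, q⟩ => ⟨?_, ?_⟩
  · rintro ⟨r, _, rfl, rfl⟩
    rfl
  · intro h
    exact ⟨fun _ => p, RunOn.refl _ _ _ _, rfl, h⟩

theorem runRel_shift (A : OrdinalAutomaton Q S) {x x' : Ordinal.{u} → S} {a a' l : Ordinal.{u}}
    (h : ∀ y < l, x (a + y) = x' (a' + y)) :
    runRel A x a (a + l) = runRel A x' a' (a' + l) := by
  have key : ∀ {x x' : Ordinal.{u} → S} {a a' : Ordinal.{u}},
      (∀ y < l, x (a + y) = x' (a' + y)) →
      (show Set (Q × Q) from runRel A x a (a + l)) ⊆ runRel A x' a' (a' + l) := by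
    rintro x x' a a' h ⟨p, q⟩ ⟨r, hr, rfl, rfl⟩
    exact ⟨_, (hr.unshift (x' := fun y => x (a + y)) fun _ _ => rfl).shift
      (x' := x') (a := a') fun y hy => (h y hy).symm, by simp, by simp⟩
  exact Set.Subset.antisymm (key h) (key fun y hy => (h y hy).symm)

theorem runRel_congr (A : OrdinalAutomaton Q S) {x x' : Ordinal.{u} → S} {a b : Ordinal.{u}}
    (h : ∀ y, a ≤ y → y < b → x y = x' y) : runRel A x a b = runRel A x' a b := by
  refine Set.ext fun z => exists_congr fun r => and_congr_left fun _ => ⟨fun hr => ?_, fun hr => ?_⟩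
  · exact hr.congr (fun _ _ _ => rfl) fun y h1 h2 => (h y h1 h2).symm
  · exact hr.congr (fun _ _ _ => rfl) h

theorem mem_runRel_const {A : OrdinalAutomaton Q S} {b : S} {l : Ordinal.{u}} {z : Q × Q} :
    z ∈ (show Set (Q × Q) from runRel A (fun _ => b) 0 l) ↔ ∃ V, Traverse A b l z.1 V z.2 :=
  ⟨fun ⟨r, h1, h2, h3⟩ => ⟨_, r, h1, h2, h3, rfl⟩, fun ⟨_, r, h1, h2, h3, _⟩ => ⟨r, h1, h2, h3⟩⟩

theorem runRel_const_subset {A : OrdinalAutomaton Q S} {b : S} {l l' : Ordinal.{u}}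
    (hl : IsSuccLimit l) (hl' : IsSuccLimit l')
    (h : ∀ q V P, Approach A b l q V P → Approach A b l' q V P) :
    (show Set (Q × Q) from runRel A (fun _ => b) 0 l) ⊆ runRel A (fun _ => b) 0 l' := by
  intro z hz
  obtain ⟨V, hV⟩ := mem_runRel_const.1 hz
  obtain ⟨P, hP, hz⟩ := hV.approach hl
  exact mem_runRel_const.2 ⟨V, (h _ _ _ hP).traverse hl' hz⟩

theorem runRel_const_of_cofOmega [Finite Q] (A : OrdinalAutomaton Q S) (b : S) {m : ℕ}
    (hm : Nat.card Q < m) {β : Ordinal.{u}} (hβ : β ≠ 0) (hcof : CofOmega (ω ^ m * β)) :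
    runRel A (fun _ => b) 0 (ω ^ m * β) = runRel A (fun _ => b) 0 ((ω : Ordinal.{u}) ^ m) := by
  obtain ⟨i, rfl⟩ : ∃ i, m = i + 1 := ⟨m - 1, by omega⟩
  have hl := isSuccLimit_omega0_pow_mul (i := i + 1) (by omega) hβ
  have hl' := isSuccLimit_omega0_pow (i := i + 1) (by omega)
  refine Set.Subset.antisymm (runRel_const_subset (A := A) (b := b) hl hl' fun q V P h => ?_)
    (runRel_const_subset (A := A) (b := b) hl' hl fun q V P h => ?_)
  · exact h.of_mul (by omega) β hβ
  · exact h.mul_of_cofOmega i ((Set.ncard_le_card P).trans (by omega)) hβ hcof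

theorem runRel_const_of_not_cofOmega [Finite Q] (A : OrdinalAutomaton Q S) (b : S) {m : ℕ}
    (hm : Nat.card Q < m) {β γ : Ordinal.{u}} (hβ : β ≠ 0) (hβ' : ¬ CofOmega (ω ^ m * β))
    (hγ : γ ≠ 0) (hγ' : ¬ CofOmega (ω ^ m * γ)) :
    runRel A (fun _ => b) 0 (ω ^ m * β) = runRel A (fun _ => b) 0 (ω ^ m * γ) := by
  obtain ⟨i, rfl⟩ : ∃ i, m = i + 1 := ⟨m - 1, by omega⟩
  have key : ∀ {β γ : Ordinal.{u}}, β ≠ 0 → ¬ CofOmega (ω ^ (i + 1) * β) → γ ≠ 0 →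
      ¬ CofOmega (ω ^ (i + 1) * γ) → (show Set (Q × Q) from
        runRel A (fun _ => b) 0 (ω ^ (i + 1) * β)) ⊆ runRel A (fun _ => b) 0 (ω ^ (i + 1) * γ) := by
    intro β γ hβ hβ' hγ hγ'
    refine runRel_const_subset (isSuccLimit_omega0_pow_mul (by omega) hβ)
      (isSuccLimit_omega0_pow_mul (by omega) hγ) fun q V P h => ?_
    -- `γ = 1` is impossible, since ω^(i+1) has countable cofinality.
    refine h.mul_of_not_cofOmega (by omega) hβ hβ' (lt_of_le_of_ne (one_le_iff_ne_zero.2 hγ) ?_)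
    rintro rfl
    exact hγ' (by simpa using cofOmega_omega0_pow_mul_add_one (β := 0) (i := i + 1) (by omega))
  exact Set.Subset.antisymm (key hβ hβ' hγ hγ') (key hγ hγ' hβ hβ')

variable (Ψ : ι → OrdinalAutomaton Q S)

/-- The relations `runRel` of the members of a family of automata. -/
def wordType (x : Ordinal.{u} → S) (a b : Ordinal.{u}) : ι → StateRel Q :=
  fun i => runRel (Ψ i) x a b

theorem wordType_mul (x : Ordinal.{u} → S) {a b c : Ordinal.{u}} (hab : a ≤ b) (hbc : b ≤ c) :
    wordType Ψ x a b * wordType Ψ x b c = wordType Ψ x a c :=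
  funext fun i => runRel_mul (Ψ i) x hab hbc

theorem wordType_self (x : Ordinal.{u} → S) (a : Ordinal.{u}) : wordType Ψ x a a = 1 :=
  funext fun i => runRel_self (Ψ i) x a

theorem wordType_shift {x x' : Ordinal.{u} → S} {a a' l : Ordinal.{u}}
    (h : ∀ y < l, x (a + y) = x' (a' + y)) :
    wordType Ψ x a (a + l) = wordType Ψ x' a' (a' + l) :=
  funext fun i => runRel_shift (Ψ i) h

theorem wordType_congr {x x' : Ordinal.{u} → S} {a b : Ordinal.{u}}
    (h : ∀ y, a ≤ y → y < b → x y = x' y) : wordType Ψ x a b = wordType Ψ x' a b :=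
  funext fun i => runRel_congr (Ψ i) h

variable (blank : S)

/-- The type of the blank word of length `l`. -/
def blankType (l : Ordinal.{u}) : ι → StateRel Q :=
  wordType Ψ (fun _ => blank) 0 l

theorem blankType_eq_wordType {x : Ordinal.{u} → S} {a l : Ordinal.{u}}
    (h : ∀ y, a ≤ y → y < a + l → x y = blank) :
    wordType Ψ x a (a + l) = blankType Ψ blank l := by
  have := wordType_shift Ψ (x := x) (x' := fun _ => blank) (a := a) (a' := 0) (l := l)
    fun y hy => h _ le_self_add (by simpa using hy)
  rwa [zero_add] at this

/-- `g` is the type of a finite word at the positions `β` with `a ≤ β < b`, where the support of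
the word is contained in `P`. -/
def Realizes (a b : Ordinal.{u}) (P : Set Ordinal.{u}) (g : ι → StateRel Q) : Prop :=
  ∃ x : Ordinal.{u} → S, {y | x y ≠ blank}.Finite ∧
    (∀ y, a ≤ y → y < b → x y ≠ blank → y ∈ P) ∧ wordType Ψ x a b = g

variable {Ψ blank} {a b c l a' : Ordinal.{u}} {P P' : Set Ordinal.{u}} {g h : ι → StateRel Q}

theorem Realizes.one (a : Ordinal.{u}) (P : Set Ordinal.{u}) :
    Realizes Ψ blank a a P 1 :=
  ⟨fun _ => blank, by simp, fun _ _ _ h => absurd rfl h, wordType_self _ _ _⟩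

theorem Realizes.of_blank (a l : Ordinal.{u}) (P : Set Ordinal.{u}) :
    Realizes Ψ blank a (a + l) P (blankType Ψ blank l) :=
  ⟨fun _ => blank, by simp, fun _ _ _ h => absurd rfl h,
    blankType_eq_wordType Ψ blank fun _ _ _ => rfl⟩

theorem Realizes.mul (H : Realizes Ψ blank a b P g) (H' : Realizes Ψ blank b c P h)
    (hab : a ≤ b) (hbc : b ≤ c) : Realizes Ψ blank a c P (g * h) := by
  obtain ⟨x, h1, h2, rfl⟩ := H
  obtain ⟨x', h1', h2', rfl⟩ := H'
  refine ⟨fun y => if y < b then x y else x' y, (h1.union h1').subset fun y hy => ?_, ?_, ?_⟩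
  · by_cases hyb : y < b
    · exact Or.inl (by simpa [hyb] using hy)
    · exact Or.inr (by simpa [hyb] using hy)
  · intro y ha hc hy
    by_cases hyb : y < b
    · exact h2 y ha hyb (by simpa [hyb] using hy)
    · exact h2' y (not_lt.1 hyb) hc (by simpa [hyb] using hy)
  · rw [← wordType_mul Ψ _ hab hbc]
    congr 1
    · exact wordType_congr Ψ fun y _ hy => by simp [hy]
    · exact wordType_congr Ψ fun y hy _ => by simp [hy.not_gt]

theorem Realizes.split (H : Realizes Ψ blank a c P g) (hab : a ≤ b) (hbc : b ≤ c) :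
    ∃ g₁ g₂, g = g₁ * g₂ ∧ Realizes Ψ blank a b P g₁ ∧ Realizes Ψ blank b c P g₂ := by
  obtain ⟨x, h1, h2, rfl⟩ := H
  exact ⟨_, _, (wordType_mul Ψ x hab hbc).symm,
    ⟨x, h1, fun y ha hb => h2 y ha (hb.trans_le hbc), rfl⟩,
    ⟨x, h1, fun y ha => h2 y (hab.trans ha), rfl⟩⟩

theorem Realizes.shift (H : Realizes Ψ blank a (a + l) P g)
    (hP : ∀ y < l, a + y ∈ P → a' + y ∈ P') : Realizes Ψ blank a' (a' + l) P' g := by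
  classical
  obtain ⟨x, h1, h2, rfl⟩ := H
  refine ⟨fun z => if a' ≤ z then x (a + (z - a')) else blank, ?_, ?_, ?_⟩
  · refine (h1.image fun z => a' + (z - a)).subset ?_
    intro z hz
    by_cases hza : a' ≤ z
    · simp only [hza, if_true, Set.mem_ofPred_eq] at hz
      exact ⟨_, hz, by simp only [Ordinal.add_sub_cancel, Ordinal.add_sub_cancel_of_le hza]⟩
    · simp [hza] at hz
  · intro z ha hb hz
    obtain ⟨y, rfl⟩ := exists_add_of_le ha
    have hy : y < l := by simpa using hb
    simp only [ha, if_true, Ordinal.add_sub_cancel] at hz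
    exact hP y hy (h2 _ le_self_add (by simpa using hy) hz)
  · exact wordType_shift Ψ fun y hy => by simp

theorem Realizes.exists_list_prod {n : ℕ} (H : Realizes Ψ blank a (a + l * n) P g) :
    ∃ L : List (ι → StateRel Q), L.length = n ∧ (∀ h ∈ L, Realizes Ψ blank 0 l Set.univ h) ∧
      L.prod = g := by
  induction n generalizing g with
  | zero =>
    obtain ⟨x, _, _, rfl⟩ := H
    exact ⟨[], rfl, by simp, by simp [wordType_self]⟩
  | succ n ih =>
    rw [Nat.cast_succ, mul_add_one, ← add_assoc] at H
    obtain ⟨g₁, g₂, rfl, H1, H2⟩ := H.split (b := a + l * n) le_self_add le_self_add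
    obtain ⟨L, h1, h2, rfl⟩ := ih H1
    refine ⟨L ++ [g₂], by simp [h1], fun h hh => ?_, by simp⟩
    rcases List.mem_append.1 hh with hh | hh
    · exact h2 h hh
    · rw [List.mem_singleton.1 hh]
      have := H2.shift (a' := 0) (P' := Set.univ) fun _ _ _ => Set.mem_univ _
      rwa [zero_add] at this

theorem mul_natCast_succ (l : Ordinal.{u}) (n : ℕ) : l * (n + 1 : ℕ) = l + l * n := by
  rw [Nat.add_comm, Nat.cast_add, Nat.cast_one, mul_one_add]

theorem Realizes.list_prod (L : List (ι → StateRel Q)) (a : Ordinal.{u})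
    (H : ∀ h ∈ L, ∀ j < L.length, Realizes Ψ blank (a + l * (j : ℕ)) (a + l * (j : ℕ) + l) P h) :
    Realizes Ψ blank a (a + l * L.length) P L.prod := by
  induction L generalizing a with
  | nil => simpa using Realizes.one a P
  | cons h L ih =>
    have h1 := H h (by simp) 0 (by simp)
    have h2 := ih (a + l) fun h' hh' j hj => by
      have := H h' (by simp [hh']) (j + 1) (by simpa using hj)
      rwa [mul_natCast_succ, ← add_assoc] at this
    rw [Nat.cast_zero, mul_zero, add_zero] at h1
    rw [List.length_cons, List.prod_cons, mul_natCast_succ, ← add_assoc]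
    exact h1.mul h2 le_self_add le_self_add

theorem exists_bound_of_finite {s : Set Ordinal.{u}} (hs : s.Finite) (hl : IsSuccLimit l) :
    ∃ x < l, ∀ y ∈ s, y < l → y < x := by
  induction s, hs using Set.Finite.induction_on with
  | empty => exact ⟨0, hl.bot_lt, by simp⟩
  | @insert z s _ _ ih =>
    obtain ⟨x, hx, h⟩ := ih
    by_cases hz : z < l
    · refine ⟨max x (z + 1), max_lt hx (hl.add_one_lt hz), ?_⟩
      rintro y (rfl | hy) hyl
      · exact (lt_add_one _).trans_le (le_max_right _ _)
      · exact (h y hy hyl).trans_le (le_max_left _ _)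
    · refine ⟨x, hx, ?_⟩
      rintro y (rfl | hy) hyl
      exacts [absurd hyl hz, h y hy hyl]

/-- Finite support is bounded below a limit, so the word is blank from some block on. The cut may be
any later `γ'`, which lets a successor be chosen. -/
theorem Realizes.exists_tail {β : Ordinal.{u}} (H : Realizes Ψ blank a (a + l * β) P g)
    (hl : 0 < l) (hβ : IsSuccLimit β) : ∃ γ < β, ∀ γ', γ ≤ γ' → γ' < β →
      ∃ g₁, Realizes Ψ blank a (a + l * γ') P g₁ ∧ g = g₁ * blankType Ψ blank (l * (β - γ')) := by
  obtain ⟨x, h1, h2, rfl⟩ := H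
  obtain ⟨z, hz, hz'⟩ := exists_bound_of_finite h1 (isSuccLimit_add a (isSuccLimit_mul_right hl hβ))
  have hza : z - a < l * β := sub_lt_of_lt_add hz (mul_pos hl hβ.bot_lt)
  obtain ⟨γ, hγ, hzγ⟩ := (lt_mul_iff_of_isSuccLimit hβ).1 hza
  refine ⟨γ, hγ, fun γ' h hγ' => ⟨wordType Ψ x a (a + l * γ'), ⟨x, h1, fun y ha hb =>
    h2 y ha (hb.trans ?_), rfl⟩, ?_⟩⟩
  · gcongr
  · have heq : a + l * γ' + l * (β - γ') = a + l * β := by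
      rw [add_assoc, ← mul_add, Ordinal.add_sub_cancel_of_le hγ'.le]
    rw [← wordType_mul Ψ x (b := a + l * γ') le_self_add (by gcongr), ← heq]
    congr 1
    refine blankType_eq_wordType Ψ blank fun y hy1 hy2 => ?_
    by_contra hc
    have h3 := hz' y hc (heq ▸ hy2)
    have h4 : a + l * γ ≤ a + l * γ' := by gcongr
    exact (h3.trans_le (le_add_sub z a)).not_ge ((add_le_add_right hzγ.le a).trans (h4.trans hy1))

theorem Realizes.replace_blocks {G : Set Ordinal.{u}} {n : ℕ}
    (hG : ∀ h : ι → StateRel Q, Realizes Ψ blank 0 l Set.univ h → Realizes Ψ blank 0 l G h)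
    (H : Realizes Ψ blank a (a + l * n) Set.univ g)
    (hP : ∀ j < n, ∀ y < l, y ∈ G → a + l * (j : Ordinal.{u}) + y ∈ P) :
    Realizes Ψ blank a (a + l * n) P g := by
  obtain ⟨L, rfl, h2, rfl⟩ := H.exists_list_prod
  refine Realizes.list_prod L a fun h hh j hj => ?_
  have := hG h (h2 h hh)
  rw [← zero_add l] at this
  exact this.shift fun y hy hyG => hP j hj y hy (by simpa using hyG)

/-- Only finitely many blocks are not blank, and their types compress to fewer than `m` factors. The
blank tail is still ω blocks long, so the total length is unchanged. -/
theorem Realizes.replace_omega0_blocks [Finite ι] [Finite Q] {G : Set Ordinal.{u}} {m : ℕ}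
    (hm : Nat.card (ι → StateRel Q) ≤ m) (hl : 0 < l)
    (hG : ∀ h : ι → StateRel Q, Realizes Ψ blank 0 l Set.univ h → Realizes Ψ blank 0 l G h)
    (H : Realizes Ψ blank a (a + l * ω) Set.univ g)
    (hP : ∀ j < m, ∀ y < l, y ∈ G → a + l * (j : Ordinal.{u}) + y ∈ P) :
    Realizes Ψ blank a (a + l * ω) P g := by
  obtain ⟨γ, hγ, H⟩ := H.exists_tail hl isSuccLimit_omega0
  obtain ⟨n, rfl⟩ := lt_omega0.1 hγ
  obtain ⟨g₁, H1, rfl⟩ := H n le_rfl hγ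
  obtain ⟨L, hL, h2, rfl⟩ := H1.exists_list_prod
  obtain ⟨L', hL', hprod, hlen⟩ := exists_short_sublist_prod_eq L
  have hsub : ∀ k : ℕ, ω - (k : Ordinal.{u}) = ω := fun k => by
    conv_lhs => rw [← natCast_add_omega0 k]
    exact Ordinal.add_sub_cancel _ _
  have h3 : Realizes Ψ blank a (a + l * L'.length) P L'.prod := by
    refine Realizes.list_prod L' a fun h hh j hj => ?_
    have := hG h (h2 h (hL'.subset hh))
    rw [← zero_add l] at this
    exact this.shift fun y hy hyG => hP j (by omega) y hy (by simpa using hyG)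
  have h4 : Realizes Ψ blank (a + l * L'.length) (a + l * ω) P (blankType Ψ blank (l * ω)) := by
    have := Realizes.of_blank (Ψ := Ψ) (blank := blank) (a + l * L'.length) (l * ω) P
    rwa [add_assoc, ← mul_add, natCast_add_omega0] at this
  rw [hsub, ← hprod]
  exact h3.mul h4 le_self_add (by gcongr; exact (natCast_lt_omega0 _).le)

end WordType

/-! ### Arithmetic of Cantor normal form coefficients -/

section Coefficients

variable {a c x y z : Ordinal.{u}} {i k m : ℕ}

theorem omega0_pow_mul_add_lt (hc : c < ω) (hy : y < ω ^ k) : ω ^ k * c + y < ω ^ (k + 1) := by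
  rw [pow_succ]
  exact lt_mul_iff.2 ⟨c, hc, y, hy, rfl⟩

theorem trunc_mul_add (hc : c < ω) (hy : y < ω ^ k) :
    trunc k (ω ^ (k + 1) * a + (ω ^ k * c + y)) = ω ^ (k + 1) * a := by
  have := omega0_pow_mul_add_lt hc hy
  rw [trunc, mul_add_div _ (omega0_pow_pos _).ne', div_eq_zero_of_lt this, add_zero]

theorem coeff_mul_add (hc : c < ω) (hy : y < ω ^ k) :
    coeff k (ω ^ (k + 1) * a + (ω ^ k * c + y)) = c := by
  have := omega0_pow_mul_add_lt hc hy
  rw [coeff, mul_add_mod_self, mod_eq_of_lt this, mul_add_div _ (omega0_pow_pos _).ne',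
    div_eq_zero_of_lt hy, add_zero]

theorem exists_eq_mul_add (k : ℕ) (z : Ordinal.{u}) :
    ∃ y < ω ^ k, z = ω ^ (k + 1) * (z / ω ^ (k + 1)) + (ω ^ k * coeff k z + y) :=
  ⟨z % ω ^ (k + 1) % ω ^ k, mod_lt _ (omega0_pow_pos k).ne', by
    rw [coeff, div_add_mod, div_add_mod]⟩

theorem omega0_pow_add_lt (hx : x < ω ^ k) (hy : y < ω ^ k) : x + y < ω ^ k := by
  rw [← opow_natCast] at *
  exact isPrincipal_add_omega0_opow _ hx hy

theorem coeff_add (hy : y < ω ^ k) : coeff k (z + y) = coeff k z := by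
  obtain ⟨w, hw, h⟩ := exists_eq_mul_add k z
  rw [h, add_assoc, add_assoc, coeff_mul_add (coeff_lt_omega0 _ _) (omega0_pow_add_lt hw hy),
    coeff_mul_add (coeff_lt_omega0 _ _) hw]

theorem trunc_add (hy : y < ω ^ k) : trunc k (z + y) = trunc k z := by
  obtain ⟨w, hw, h⟩ := exists_eq_mul_add k z
  rw [h, add_assoc, add_assoc, trunc_mul_add (coeff_lt_omega0 _ _) (omega0_pow_add_lt hw hy),
    trunc_mul_add (coeff_lt_omega0 _ _) hw]

theorem coeff_mul_add_of_lt (hk : k < i) : coeff k (ω ^ i * a + y) = coeff k y := by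
  obtain ⟨d, rfl⟩ := Nat.exists_eq_add_of_lt hk
  rw [coeff, show k + d + 1 = (k + 1) + d by omega, pow_add, mul_assoc, mul_add_mod_self, coeff]

theorem coeff_eq_zero (hy : y < ω ^ k) : coeff k y = 0 := by
  rw [coeff, mod_eq_of_lt (hy.trans_le (pow_le_pow_right₀ one_lt_omega0.le (Nat.le_succ k))),
    div_eq_zero_of_lt hy]

end Coefficients

/-! ### Words of length ω^i with small coefficients -/

section Blocks

variable {Q : Type w} {S : Type v} {ι : Type*} [Finite ι] [Finite Q]
  {Ψ : ι → OrdinalAutomaton Q S} {blank : S}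

/-- The ordinals all of whose coefficients are at most `m`. -/
def smallCoeff (m : ℕ) : Set Ordinal.{u} :=
  {y | ∀ k, coeff k y ≤ m}

/-- Induction on `i`: the ω blocks of length ω^i compress into the first `m` of them, which bounds
coefficient `i`, and the induction hypothesis inside each block bounds the lower ones. -/
theorem Realizes.restrict_smallCoeff {m : ℕ} (hm : Nat.card (ι → StateRel Q) ≤ m) (i : ℕ)
    {g : ι → StateRel Q} (H : Realizes Ψ blank 0 ((ω : Ordinal.{u}) ^ i) Set.univ g) :
    Realizes Ψ blank 0 ((ω : Ordinal.{u}) ^ i) (smallCoeff m) g := by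
  induction i generalizing g with
  | zero =>
    obtain ⟨x, h1, _, rfl⟩ := H
    refine ⟨x, h1, fun y _ hy _ => ?_, rfl⟩
    have : y = 0 := by simpa using hy
    subst this
    intro k
    rw [coeff_eq_zero (omega0_pow_pos k)]
    exact zero_le
  | succ i ih =>
    rw [← zero_add (ω ^ (i + 1)), pow_succ] at H ⊢
    refine H.replace_omega0_blocks hm (omega0_pow_pos i) (fun h => ih) fun j hj y hy hyG k => ?_
    rw [zero_add]
    rcases lt_trichotomy k i with hk | rfl | hk
    · rw [coeff_mul_add_of_lt hk]
      exact hyG k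
    · have := coeff_mul_add (a := 0) (natCast_lt_omega0 j) hy
      rw [mul_zero, zero_add] at this
      rw [this]
      exact_mod_cast hj.le
    · rw [coeff_eq_zero]
      · exact zero_le
      · exact (omega0_pow_mul_add_lt (natCast_lt_omega0 j) hy).trans_le
          (pow_le_pow_right₀ one_lt_omega0.le hk)

end Blocks

/-! ### The ordinal ω₁: cofinality and absorption -/

section OmegaOne

variable {l x : Ordinal.{u}}

theorem not_cofOmega_omega_one : ¬ CofOmega (ω₁ : Ordinal.{u}) := by
  rintro ⟨f, hf, h⟩
  have h1 : ⨆ k, f k < ω₁ := Ordinal.iSup_lt_omega_one hf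
  obtain ⟨k, hk⟩ := h _ ((Cardinal.isSuccLimit_omega 1).add_one_lt h1)
  exact (lt_add_one _).not_ge (hk.trans (Ordinal.le_iSup f k))

theorem omega_one_le_of_not_cofOmega (hl : l ≠ 0) (h : ¬ CofOmega l) : ω₁ ≤ l := by
  by_contra! hlt
  rw [Cardinal.lt_omega_iff_card_lt, ← Cardinal.succ_aleph0, Order.lt_succ_iff] at hlt
  have : Countable (Set.Iio l) := by
    rw [← Cardinal.mk_le_aleph0_iff, Cardinal.mk_Iio_ordinal]
    simpa using Cardinal.lift_le.2 hlt
  have : Nonempty (Set.Iio l) := ⟨⟨0, pos_iff_ne_zero.2 hl⟩⟩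
  obtain ⟨f, hf⟩ := exists_surjective_nat (Set.Iio l)
  refine h ⟨fun k => f k, fun k => (f k).2, fun x hx => ?_⟩
  obtain ⟨k, hk⟩ := hf ⟨x, hx⟩
  exact ⟨k, by simp [hk]⟩

theorem add_omega_one (h : x < ω₁) : x + ω₁ = ω₁ :=
  (isPrincipal_add_omega 1).add_eq_right h

theorem omega0_pow_lt_omega_one (k : ℕ) : (ω : Ordinal.{u}) ^ k < ω₁ := by
  rw [← opow_natCast]
  exact isPrincipal_opow_omega 1 omega0_lt_omega_one
    ((natCast_lt_omega0 k).trans omega0_lt_omega_one)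

theorem omega0_pow_mul_omega_one (k : ℕ) : (ω : Ordinal.{u}) ^ k * ω₁ = ω₁ :=
  isPrincipal_mul_iff_mul_left_eq.1 (isPrincipal_mul_omega 1) _ (omega0_pow_pos k)
    (omega0_pow_lt_omega_one k)

theorem omega0_pow_mul_natCast_add_omega_one (k j : ℕ) :
    (ω : Ordinal.{u}) ^ k * j + ω₁ = ω₁ := by
  refine add_omega_one (lt_of_le_of_lt ?_ (omega0_pow_lt_omega_one (k + 1)))
  rw [pow_succ]
  exact mul_le_mul_right (natCast_lt_omega0 j).le _

end OmegaOne

/-! ### Words whose length is a multiple of ω^(m+1) -/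

section Middle

variable {Q : Type w} {S : Type v} {ι : Type*} [Finite Q]
  {Ψ : ι → OrdinalAutomaton Q S} {blank : S} {m : ℕ}

theorem blankType_of_cofOmega (hm : Nat.card Q < m) {β : Ordinal.{u}} (hβ : β ≠ 0)
    (h : CofOmega (ω ^ m * β)) :
    blankType Ψ blank (ω ^ m * β) = blankType Ψ blank ((ω : Ordinal.{u}) ^ m) :=
  funext fun _ => runRel_const_of_cofOmega _ _ hm hβ h

theorem blankType_of_not_cofOmega (hm : Nat.card Q < m) {β : Ordinal.{u}} (hβ : β ≠ 0)
    (h : ¬ CofOmega (ω ^ m * β)) :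
    blankType Ψ blank (ω ^ m * β) = blankType Ψ blank (ω₁ : Ordinal.{u}) := by
  rw [← omega0_pow_mul_omega_one m]
  refine funext fun _ => runRel_const_of_not_cofOmega _ _ hm hβ h (omega_pos 1).ne' ?_
  rw [omega0_pow_mul_omega_one]
  exact not_cofOmega_omega_one

theorem blankType_eq_of_cofOmega_iff (hm : Nat.card Q < m) {β γ : Ordinal.{u}} (hβ : β ≠ 0)
    (hγ : γ ≠ 0) (h : CofOmega (ω ^ m * β) ↔ CofOmega (ω ^ m * γ)) :
    blankType Ψ blank (ω ^ m * β) = blankType Ψ blank (ω ^ m * γ) := by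
  by_cases hc : CofOmega (ω ^ m * β)
  · rw [blankType_of_cofOmega hm hβ hc, blankType_of_cofOmega hm hγ (h.1 hc)]
  · rw [blankType_of_not_cofOmega hm hβ hc,
      blankType_of_not_cofOmega hm hγ (fun h' => hc (h.2 h'))]

/-- The submonoid generated by the types of the finite words of length `ω ^ m`. -/
def blockMonoid (Ψ : ι → OrdinalAutomaton Q S) (blank : S) (m : ℕ) : Submonoid (ι → StateRel Q) :=
  Submonoid.closure {g | Realizes Ψ blank 0 ((ω : Ordinal.{u}) ^ m) Set.univ g}

/-- At each limit of blocks the word ends in a blank stretch, worth a single block ω^m in countable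
cofinality and ω₁ otherwise. A stretch of the second kind is at least ω₁ long, whence the bound on
the number of factors: the compressed word must fit into the original length. -/
theorem Realizes.exists_factorization (hm : Nat.card Q < m) (β : Ordinal.{u}) :
    ∀ g, ¬ IsSuccLimit β → Realizes Ψ blank 0 (ω ^ m * β) Set.univ g →
    ∃ (L : List (ι → StateRel Q)) (h : ι → StateRel Q),
      (∀ x ∈ L, ∃ y ∈ blockMonoid.{u} Ψ blank m, x = y * blankType Ψ blank (ω₁ : Ordinal.{u})) ∧
      h ∈ blockMonoid.{u} Ψ blank m ∧ ω₁ * (L.length : Ordinal.{u}) ≤ ω ^ m * β ∧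
      g = L.prod * h := by
  induction β using WellFoundedLT.induction with
  | ind β ih =>
  intro g hβ H
  rcases zero_or_succ_or_isSuccLimit β with rfl | ⟨β', rfl⟩ | h
  · obtain ⟨x, _, _, rfl⟩ := H
    exact ⟨[], 1, by simp, one_mem _, by simp, by simp [wordType_self]⟩
  · rw [mul_succ] at H ⊢
    obtain ⟨g₁, g₂, rfl, H1, H2⟩ := H.split (b := ω ^ m * β') zero_le le_self_add
    have hg₂ : g₂ ∈ blockMonoid.{u} Ψ blank m := by
      have := H2.shift (a' := 0) (P' := Set.univ) fun _ _ _ => Set.mem_univ _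
      rw [zero_add] at this
      exact Submonoid.subset_closure this
    by_cases hl : IsSuccLimit β'
    · rw [← zero_add (ω ^ m * β')] at H1
      obtain ⟨γ, hγ, H3⟩ := H1.exists_tail (omega0_pow_pos m) hl
      -- Cutting at a successor keeps the induction hypothesis, which excludes limits, applicable.
      obtain ⟨g₁', H4, rfl⟩ := H3 (γ + 1) (le_self_add) (hl.add_one_lt hγ)
      rw [zero_add] at H4
      have hη0 : β' - (γ + 1) ≠ 0 := Ordinal.sub_ne_zero_iff_lt.2 (hl.add_one_lt hγ)
      have hη : (ω ^ m * (γ + 1) + ω ^ m * (β' - (γ + 1)) : Ordinal.{u}) = ω ^ m * β' := by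
        rw [← mul_add, Ordinal.add_sub_cancel_of_le (hl.add_one_lt hγ).le]
      obtain ⟨L, h, hL, hh, hle, rfl⟩ := ih (γ + 1) ((hl.add_one_lt hγ).trans (lt_succ β')) g₁'
        (by rw [← succ_eq_add_one]; exact not_isSuccLimit_succ γ) H4
      set η := β' - (γ + 1)
      by_cases hc : CofOmega (ω ^ m * η)
      · refine ⟨L, h * blankType Ψ blank ((ω : Ordinal.{u}) ^ m) * g₂, hL,
          mul_mem (mul_mem hh (Submonoid.subset_closure ?_)) hg₂, ?_, ?_⟩
        · have := Realizes.of_blank (Ψ := Ψ) (blank := blank) (0 : Ordinal.{u}) (ω ^ m) Set.univ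
          rwa [zero_add] at this
        · exact hle.trans ((le_self_add.trans hη.le).trans le_self_add)
        · rw [blankType_of_cofOmega hm hη0 hc]
          simp only [mul_assoc]
      · refine ⟨L ++ [h * blankType Ψ blank (ω₁ : Ordinal.{u})], g₂, ?_, hg₂, ?_, ?_⟩
        · intro x hx
          rcases List.mem_append.1 hx with hx | hx
          · exact hL x hx
          · exact ⟨h, hh, List.mem_singleton.1 hx⟩
        · rw [List.length_append, List.length_singleton, Nat.cast_add, Nat.cast_one, mul_add_one,
            ← hη]
          exact (add_le_add hle (omega_one_le_of_not_cofOmega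
            (mul_ne_zero (omega0_pow_pos m).ne' hη0) hc)).trans le_self_add
        · rw [blankType_of_not_cofOmega hm hη0 hc]
          simp [mul_assoc]
    · obtain ⟨L, h, hL, hh, hle, rfl⟩ := ih β' (lt_succ β') g₁ hl H1
      exact ⟨L, h * g₂, hL, mul_mem hh hg₂, hle.trans le_self_add, mul_assoc _ _ _⟩
  · exact absurd h hβ

variable [Finite ι]

theorem Realizes.of_mem_blockMonoid (hm : Nat.card (ι → StateRel Q) ≤ m) {g : ι → StateRel Q}
    (hg : g ∈ blockMonoid.{u} Ψ blank m) : ∃ n < m, Realizes Ψ blank 0 ((ω : Ordinal.{u}) ^ m * n)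
      {x | ∃ j < m, ∃ y ∈ smallCoeff m, y < ω ^ m ∧ x = ω ^ m * (j : ℕ) + y} g := by
  obtain ⟨L, hL, rfl⟩ := Submonoid.exists_list_of_mem_closure hg
  obtain ⟨L', hL', hprod, hlen⟩ := exists_short_sublist_prod_eq L
  refine ⟨L'.length, by omega, ?_⟩
  rw [← hprod, ← zero_add (ω ^ m * _)]
  refine Realizes.list_prod L' 0 fun h hh j hj => ?_
  have := Realizes.restrict_smallCoeff hm m (hL h (hL'.subset hh))
  rw [← zero_add (ω ^ m)] at this
  exact this.shift fun y hy hyG => ⟨j, by omega, y, by simpa using hyG, hy, by simp⟩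

/-- After compression fewer than `m` factors remain that end in a blank ω₁. Each is realized on
exactly ω₁ positions, because ω₁ absorbs the few blocks of length ω^m before it. One further group
of such blocks follows, then blanks. -/
theorem Realizes.replace_middle (hm : Nat.card (ι → StateRel Q) ≤ m) (hm' : Nat.card Q < m)
    {δ : Ordinal.{u}} (hδ : δ ≠ 0) {g : ι → StateRel Q}
    (H : Realizes Ψ blank 0 (ω ^ (m + 1) * δ) Set.univ g) :
    Realizes Ψ blank 0 (ω ^ (m + 1) * δ) {x | ∃ c < m, ∃ j < m, ∃ y ∈ smallCoeff m, y < ω ^ m ∧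
      x = ω₁ * (c : ℕ) + (ω ^ m * (j : ℕ) + y)} g := by
  set G : Set Ordinal.{u} := {x | ∃ c < m, ∃ j < m, ∃ y ∈ smallCoeff m, y < ω ^ m ∧
      x = ω₁ * (c : ℕ) + (ω ^ m * (j : ℕ) + y)} with hG
  have hlim : IsSuccLimit (ω * δ) := isSuccLimit_mul_left isSuccLimit_omega0 (pos_iff_ne_zero.2 hδ)
  have hlen : (ω ^ (m + 1) * δ : Ordinal.{u}) = ω ^ m * (ω * δ) := by rw [pow_succ, mul_assoc]
  rw [hlen, ← zero_add (ω ^ m * _)] at H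
  obtain ⟨γ, hγ, H⟩ := H.exists_tail (omega0_pow_pos m) hlim
  have hγ1 := hlim.add_one_lt hγ
  obtain ⟨g₁, H1, rfl⟩ := H (γ + 1) le_self_add hγ1
  rw [zero_add] at H1
  obtain ⟨L, h, hL, hh, hle, rfl⟩ := H1.exists_factorization hm' (γ + 1)
    g₁ (by rw [← succ_eq_add_one]; exact not_isSuccLimit_succ γ)
  obtain ⟨L', hL', hprod, hlen'⟩ := exists_short_sublist_prod_eq L
  rw [← hprod]
  clear hprod
  have hle' : ω₁ * (L'.length : Ordinal.{u}) < ω ^ (m + 1) * δ := by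
    rw [hlen]
    refine lt_of_le_of_lt (le_trans ?_ hle) ((mul_lt_mul_iff_right₀ (omega0_pow_pos m)).2 hγ1)
    exact mul_le_mul_right (Nat.cast_le.2 hL'.length_le) _
  have h1 : Realizes Ψ blank (0 + ω₁ * (0 : ℕ)) (0 + ω₁ * (L'.length : Ordinal.{u})) G L'.prod := by
    rw [Nat.cast_zero, mul_zero, add_zero]
    refine Realizes.list_prod L' 0 fun x hx j hj => ?_
    obtain ⟨y, hy, rfl⟩ := hL x (hL'.subset hx)
    obtain ⟨n, hn, hR⟩ := Realizes.of_mem_blockMonoid hm hy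
    have := hR.mul ((Realizes.of_blank _ ω₁ _)) zero_le le_self_add
    rw [omega0_pow_mul_natCast_add_omega_one] at this
    refine Realizes.shift (a := 0) (by rwa [zero_add]) fun y hy hyG => ?_
    rw [zero_add] at hyG ⊢
    obtain ⟨j', hj', z, hz, hz', rfl⟩ := hyG
    exact ⟨j, by omega, j', hj', z, hz, hz', rfl⟩
  obtain ⟨n, hn, hR⟩ := Realizes.of_mem_blockMonoid hm hh
  have h2 : Realizes Ψ blank (ω₁ * (L'.length : Ordinal.{u})) (ω₁ * L'.length + ω ^ m * n) G h := by
    rw [← zero_add (ω ^ m * _)] at hR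
    refine hR.shift fun y hy hyG => ?_
    rw [zero_add] at hyG
    obtain ⟨j', hj', z, hz, hz', rfl⟩ := hyG
    exact ⟨_, by omega, j', hj', z, hz, hz', rfl⟩
  rw [Nat.cast_zero, mul_zero, zero_add, zero_add] at h1
  have h12 := h1.mul h2 zero_le le_self_add
  -- As ω₁ absorbs ω^(m+1) on its left, the bound below ω^(m+1) δ becomes a bound below `δ`; the
  -- remaining length is then a nonzero multiple of ω^(m+1).
  have hc : ω₁ * (L'.length : Ordinal.{u}) = ω ^ (m + 1) * (ω₁ * L'.length) := by
    rw [← mul_assoc, omega0_pow_mul_omega_one]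
  have hlt : ω₁ * (L'.length : Ordinal.{u}) < δ := by
    rw [hc] at hle'
    exact (mul_lt_mul_iff_right₀ (omega0_pow_pos _)).1 hle'
  have hρ0 := Ordinal.sub_ne_zero_iff_lt.2 hlt
  set ρ := δ - ω₁ * (L'.length : Ordinal.{u})
  have hrest : ω₁ * (L'.length : Ordinal.{u}) + ω ^ (m + 1) * ρ = ω ^ (m + 1) * δ := by
    conv_lhs => rw [hc]
    rw [← mul_add, Ordinal.add_sub_cancel_of_le hlt.le]
  have hrest' : ω₁ * (L'.length : Ordinal.{u}) + ω ^ m * n + ω ^ (m + 1) * ρ = ω ^ (m + 1) * δ := by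
    rw [add_assoc, omega0_pow_mul_add _ hρ0 (natCast_lt_omega0 n), hrest]
  have h3 := h12.mul (Realizes.of_blank _ (ω ^ (m + 1) * ρ) G) zero_le le_self_add
  rw [hrest'] at h3
  convert h3 using 2
  have hη0 : ω * δ - (γ + 1) ≠ 0 := Ordinal.sub_ne_zero_iff_lt.2 hγ1
  have hη : (ω ^ m * (γ + 1) + ω ^ m * (ω * δ - (γ + 1)) : Ordinal.{u}) = ω ^ (m + 1) * δ := by
    rw [← mul_add, Ordinal.add_sub_cancel_of_le hγ1.le, hlen]
  have hωρ : ω * ρ ≠ 0 := mul_ne_zero omega0_ne_zero hρ0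
  rw [pow_succ, mul_assoc] at hrest ⊢
  -- Old and new blank tails are both final pieces of the total length ω^(m+1) δ, so they agree on
  -- countable cofinality and hence have the same type.
  refine blankType_eq_of_cofOmega_iff hm' hη0 hωρ ?_
  rw [← cofOmega_add_iff (a := ω ^ m * (γ + 1)) (mul_ne_zero (omega0_pow_pos m).ne' hη0), hη,
    ← cofOmega_add_iff (a := ω₁ * (L'.length : Ordinal.{u}))
      (mul_ne_zero (omega0_pow_pos m).ne' hωρ), hrest, pow_succ, mul_assoc]

end Middle

/-! ### Membership in the sets U -/

section Neighbourhoods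

variable {m i k : ℕ} {β γ c y : Ordinal.{u}}

/-- The largest multiple of `ω ^ i` that is at most `β`. -/
noncomputable def floorPow (i : ℕ) (β : Ordinal.{u}) : Ordinal.{u} :=
  ω ^ i * (β / ω ^ i)

theorem floorPow_zero (β : Ordinal.{u}) : floorPow 0 β = β := by
  simp [floorPow]

theorem floorPow_succ_add (i : ℕ) (β : Ordinal.{u}) :
    floorPow (i + 1) β + ω ^ i * coeff i β = floorPow i β := by
  cases i with
  | zero =>
    rw [floorPow_zero, pow_zero, one_mul]
    exact trunc_zero_add β
  | succ n => exact trunc_succ_add n β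

theorem exists_floorPow_add_eq (i : ℕ) (β : Ordinal.{u}) :
    ∃ r < ω ^ i, floorPow i β + r = β :=
  ⟨β % ω ^ i, mod_lt _ (omega0_pow_pos i).ne', div_add_mod _ _⟩

theorem coeff_floorPow_add (hk : i ≤ k) (hy : y < ω ^ i) :
    coeff k (floorPow i β + y) = coeff k β := by
  have hle : (ω : Ordinal.{u}) ^ i ≤ ω ^ k := pow_le_pow_right₀ one_lt_omega0.le hk
  obtain ⟨r, hr, h⟩ := exists_floorPow_add_eq i β
  rw [coeff_add (hy.trans_le hle)]
  conv_rhs => rw [← h, coeff_add (hr.trans_le hle)]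

theorem trunc_floorPow_add (hk : i ≤ k) (hy : y < ω ^ i) :
    trunc k (floorPow i β + y) = trunc k β := by
  have hle : (ω : Ordinal.{u}) ^ i ≤ ω ^ k := pow_le_pow_right₀ one_lt_omega0.le hk
  obtain ⟨r, hr, h⟩ := exists_floorPow_add_eq i β
  rw [trunc_add (hy.trans_le hle)]
  conv_rhs => rw [← h, trunc_add (hr.trans_le hle)]

theorem coeff_le_of_mem_smallCoeff (hy : y ∈ smallCoeff m) (hk : k < i) (a c : Ordinal.{u}) :
    coeff k (ω ^ (i + 1) * a + (ω ^ i * c + y)) ≤ m := by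
  rw [coeff_mul_add_of_lt (hk.trans (Nat.lt_succ_self i)), coeff_mul_add_of_lt hk]
  exact hy k

theorem mem_U_of_coeff_ne (hi : i ≤ m) (hc : c < ω) (hy : y < ω ^ i) (hy' : y ∈ smallCoeff m)
    (hne : c ≠ coeff i β) (hle : c ≤ coeff i β + m) :
    floorPow (i + 1) β + (ω ^ i * c + y) ∈ U m β := by
  have hlt := omega0_pow_mul_add_lt hc hy
  have hcoeff : coeff i (floorPow (i + 1) β + (ω ^ i * c + y)) = c := coeff_mul_add hc hy
  refine Or.inr (Or.inl ⟨?_, i, hi, by rwa [hcoeff], fun j _ hj => coeff_floorPow_add hj hlt,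
    by rwa [hcoeff], fun k hk => coeff_le_of_mem_smallCoeff hy' hk _ _⟩)
  rcases hi.lt_or_eq with hi | rfl
  · exact trunc_floorPow_add hi hlt
  · exact trunc_mul_add hc hy

theorem mem_U_of_omega_one {j d : ℕ} (hd : d ≠ 0) (hdm : d ≤ m) (hj : j ≤ m) (hy : y < ω ^ m)
    (hy' : y ∈ smallCoeff m) :
    floorPow (m + 1) β + ω₁ * (d : Ordinal.{u}) + (ω ^ m * (j : Ordinal.{u}) + y) ∈ U m β := by
  have h : floorPow (m + 1) β + ω₁ * (d : Ordinal.{u}) =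
      ω ^ (m + 1) * (β / ω ^ (m + 1) + ω₁ * d) := by
    rw [mul_add, ← mul_assoc, omega0_pow_mul_omega_one, floorPow]
  rw [h]
  refine Or.inr (Or.inr ⟨d, by omega, hdm, ?_, fun i hi => ?_⟩)
  · rw [trunc_mul_add (natCast_lt_omega0 j) hy, ← h]
    rfl
  · rcases hi.lt_or_eq with hi | rfl
    · exact coeff_le_of_mem_smallCoeff hy' hi _ _
    · rw [coeff_mul_add (natCast_lt_omega0 j) hy]
      exact_mod_cast hj

/-- A nonzero multiple of ω^(i+1) absorbs the finite multiple of ω^i to its left. -/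
theorem floorPow_add_add (i : ℕ) (β : Ordinal.{u}) {η : Ordinal.{u}} (hη : η ≠ 0) :
    floorPow i β + ω ^ i + ω ^ (i + 1) * η = floorPow (i + 1) β + ω ^ (i + 1) * η := by
  rw [← floorPow_succ_add i β, add_assoc, add_assoc, ← add_assoc (ω ^ i * coeff i β),
    ← mul_add_one, omega0_pow_mul_add _ hη (isSuccLimit_omega0.add_one_lt (coeff_lt_omega0 i β))]

end Neighbourhoods

/-! ### Replacing the word on a gap between two points -/

section Segments

variable {Q : Type w} {S : Type v} {ι : Type*} [Finite ι] [Finite Q]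
  {Ψ : ι → OrdinalAutomaton Q S} {blank : S} {m : ℕ} {g : ι → StateRel Q}
  {γ γ' : Ordinal.{u}} {P : Set Ordinal.{u}}

/-- Climbing from `γ` to the next multiple of ω^(i+1) passes the next multiple of ω^i and then ω
blocks of length ω^i, which are compressed. -/
theorem Realizes.replace_up (hm : Nat.card (ι → StateRel Q) ≤ m) (hP : U m γ ⊆ P) {k : ℕ}
    (hk : k ≤ m + 1) (H : Realizes Ψ blank (γ + 1) (floorPow k γ + ω ^ k) Set.univ g) :
    Realizes Ψ blank (γ + 1) (floorPow k γ + ω ^ k) P g := by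
  have hstep : ∀ i, floorPow (i + 1) γ + ω ^ (i + 1) = floorPow i γ + ω ^ i + ω ^ i * ω := by
    intro i
    simpa [pow_succ] using (floorPow_add_add i γ one_ne_zero).symm
  have hle : ∀ i, γ + 1 ≤ floorPow i γ + ω ^ i := by
    intro i
    obtain ⟨r, hr, h⟩ := exists_floorPow_add_eq i γ
    refine add_one_le_of_lt ?_
    conv_lhs => rw [← h]
    simpa using hr
  induction k generalizing g with
  | zero =>
    rw [floorPow_zero, pow_zero] at H ⊢
    obtain ⟨x, _, _, rfl⟩ := H
    rw [wordType_self]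
    exact Realizes.one _ _
  | succ i ih =>
    rw [hstep] at H ⊢
    obtain ⟨g₁, g₂, rfl, H1, H2⟩ := H.split (hle i) le_self_add
    refine (ih (by omega) H1).mul ?_ (hle i) le_self_add
    refine H2.replace_omega0_blocks hm (omega0_pow_pos i)
      (fun h => Realizes.restrict_smallCoeff hm i) fun j hj y hy hyG => hP ?_
    have hc := isSuccLimit_omega0.add_one_lt (coeff_lt_omega0 i γ)
    rw [← floorPow_succ_add i γ, add_assoc (floorPow (i + 1) γ), ← mul_add_one,
      add_assoc (floorPow (i + 1) γ), ← mul_add, add_assoc]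
    -- Coefficient `i` grows by `1 + j` with `j < m`, thus by at most `m`, as `U` allows.
    refine mem_U_of_coeff_ne (by omega) (isPrincipal_add_omega0 hc (natCast_lt_omega0 j)) hy hyG
      ?_ ?_
    · exact ((lt_add_one _).trans_le le_self_add).ne'
    · rw [add_assoc]
      gcongr
      rw [← Nat.cast_one, ← Nat.cast_add]
      exact Nat.cast_le.2 (by omega)

/-- On the way up to `γ` there are only finitely many blocks at each level, with leading coefficient
below that of `γ`; their number need not be reduced, only their interiors. -/
theorem Realizes.replace_down (hm : Nat.card (ι → StateRel Q) ≤ m) (hP : U m γ ⊆ P) {k : ℕ}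
    (hk : k ≤ m + 1) (H : Realizes Ψ blank (floorPow k γ) γ Set.univ g) :
    Realizes Ψ blank (floorPow k γ) γ P g := by
  induction k generalizing g with
  | zero =>
    rw [floorPow_zero] at H ⊢
    obtain ⟨x, _, _, rfl⟩ := H
    rw [wordType_self]
    exact Realizes.one _ _
  | succ i ih =>
    have hle : floorPow (i + 1) γ ≤ floorPow i γ := floorPow_succ_add i γ ▸ le_self_add
    have hle' : floorPow i γ ≤ γ := mul_div_le γ (ω ^ i)
    obtain ⟨g₁, g₂, rfl, H1, H2⟩ := H.split hle hle'
    refine Realizes.mul ?_ (ih (by omega) H2) hle hle'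
    obtain ⟨n, hn⟩ := lt_omega0.1 (coeff_lt_omega0 i γ)
    rw [← floorPow_succ_add i γ, hn] at H1 ⊢
    refine H1.replace_blocks (fun h => Realizes.restrict_smallCoeff hm i)
      fun j hj y hy hyG => hP ?_
    rw [add_assoc]
    refine mem_U_of_coeff_ne (by omega) (natCast_lt_omega0 j) hy hyG ?_ ?_
    · rw [hn]
      exact (Nat.cast_lt.2 hj).ne
    · rw [hn]
      exact (Nat.cast_le.2 hj.le).trans le_self_add

/-- If the endpoints differ above level `m`, the gap is a climb from `γ`, a multiple of ω^(m+1), and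
the final approach to `γ'`. Otherwise the middle consists of finitely many blocks at the highest
level where the endpoints differ. -/
theorem Realizes.replace_segment (hm : Nat.card (ι → StateRel Q) ≤ m) (hm' : Nat.card Q < m)
    (hγ : γ < γ') (H : Realizes Ψ blank (γ + 1) γ' Set.univ g) :
    Realizes Ψ blank (γ + 1) γ' (U m γ ∪ U m γ') g := by
  have hup : ∀ i, γ + 1 ≤ floorPow i γ + ω ^ i := by
    intro i
    obtain ⟨r, hr, h⟩ := exists_floorPow_add_eq i γ
    refine add_one_le_of_lt ?_
    conv_lhs => rw [← h]
    simpa using hr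
  have hdown : ∀ i, floorPow i γ' ≤ γ' := fun i => mul_div_le γ' (ω ^ i)
  have main : ∀ k ≤ m, floorPow k γ + ω ^ k ≤ floorPow k γ' →
      (∀ h, Realizes Ψ blank (floorPow k γ + ω ^ k) (floorPow k γ') Set.univ h →
        Realizes Ψ blank (floorPow k γ + ω ^ k) (floorPow k γ') (U m γ ∪ U m γ') h) →
      Realizes Ψ blank (γ + 1) γ' (U m γ ∪ U m γ') g := by
    intro k hk hle hmid
    obtain ⟨g₁, g₂, rfl, H1, H2⟩ := H.split ((hup k).trans hle) (hdown k)
    obtain ⟨g₃, g₄, rfl, H3, H4⟩ := H1.split (hup k) hle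
    exact ((H3.replace_up hm Set.subset_union_left (by omega)).mul (hmid _ H4) (hup k) hle).mul
      (H2.replace_down hm Set.subset_union_right (by omega)) ((hup k).trans hle) (hdown k)
  rcases (div_le_left hγ.le (ω ^ (m + 1))).lt_or_eq with hlt | heq
  · have hδ0 := Ordinal.sub_ne_zero_iff_lt.2 hlt
    have hδ := Ordinal.add_sub_cancel_of_le hlt.le
    set δ := γ' / ω ^ (m + 1) - γ / ω ^ (m + 1)
    have hend : floorPow m γ + ω ^ m + ω ^ (m + 1) * δ = floorPow (m + 1) γ' := by
      rw [floorPow_add_add m γ hδ0, floorPow, ← mul_add, hδ, floorPow]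
    have hle : floorPow (m + 1) γ' ≤ floorPow m γ' := floorPow_succ_add m γ' ▸ le_self_add
    have hle1 : floorPow m γ + ω ^ m ≤ floorPow (m + 1) γ' := hend ▸ le_self_add
    obtain ⟨g₁, g₂, rfl, H1, H2⟩ := H.split ((hup m).trans hle1) (hdown _)
    obtain ⟨g₃, g₄, rfl, H3, H4⟩ := H1.split (hup m) hle1
    refine ((H3.replace_up hm Set.subset_union_left (by omega)).mul ?_ (hup m) hle1).mul
      (H2.replace_down hm Set.subset_union_right (by omega)) ((hup m).trans hle1) (hdown _)
    rw [← hend] at H4 ⊢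
    have H5 := H4.shift (a' := 0) (P' := Set.univ) fun _ _ _ => Set.mem_univ _
    rw [zero_add] at H5
    have H6 := H5.replace_middle hm hm' hδ0
    rw [← zero_add (ω ^ (m + 1) * δ)] at H6
    refine H6.shift fun z _ hz => Or.inl ?_
    rw [zero_add] at hz
    obtain ⟨c, hc, j, hj, y, hyG, hy, rfl⟩ := hz
    -- For `c = 0` the position differs from `γ` first in coefficient `m`; for `c > 0` the summand
    -- ω₁ c absorbs the lower part of `γ`, leading to the third clause of `U`.
    rcases eq_or_ne c 0 with rfl | hc0
    · have hcoeff := isSuccLimit_omega0.add_one_lt (coeff_lt_omega0 m γ)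
      rw [Nat.cast_zero, mul_zero, zero_add, ← floorPow_succ_add m γ,
        add_assoc (floorPow (m + 1) γ), ← mul_add_one, add_assoc, ← add_assoc _ _ y, ← mul_add]
      refine mem_U_of_coeff_ne le_rfl (isPrincipal_add_omega0 hcoeff (natCast_lt_omega0 j)) hy hyG
        ?_ ?_
      · exact ((lt_add_one _).trans_le le_self_add).ne'
      · rw [add_assoc]
        gcongr
        rw [← Nat.cast_one, ← Nat.cast_add]
        exact Nat.cast_le.2 (by omega)
    · have hω : ω₁ * (c : Ordinal.{u}) = ω ^ (m + 1) * (ω₁ * c) := by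
        rw [← mul_assoc, omega0_pow_mul_omega_one]
      rw [← add_assoc, hω, floorPow_add_add m γ
        (mul_ne_zero (omega_pos 1).ne' (Nat.cast_ne_zero.2 hc0)), ← hω]
      exact mem_U_of_omega_one hc0 hc.le hj.le hy hyG
  · have hex : ∃ k, γ / ω ^ k = γ' / ω ^ k := ⟨_, heq⟩
    classical
    have hk0 : Nat.find hex ≠ 0 := by
      intro h0
      have := Nat.find_spec hex
      rw [h0, pow_zero, div_one, div_one] at this
      exact hγ.ne this
    obtain ⟨k, hk⟩ := Nat.exists_eq_succ_of_ne_zero hk0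
    have hkm : k ≤ m := by
      have := Nat.find_min' hex heq
      omega
    have hne : γ / ω ^ k ≠ γ' / ω ^ k := Nat.find_min hex (by omega)
    have heq : floorPow (k + 1) γ = floorPow (k + 1) γ' := by
      have := Nat.find_spec hex
      rw [hk] at this
      exact congrArg (ω ^ (k + 1) * ·) this
    have hlt : floorPow k γ < floorPow k γ' :=
      (mul_lt_mul_iff_right₀ (omega0_pow_pos k)).2 ((div_le_left hγ.le _).lt_of_ne hne)
    obtain ⟨n, hn⟩ := lt_omega0.1 (coeff_lt_omega0 k γ)
    obtain ⟨n', hn'⟩ := lt_omega0.1 (coeff_lt_omega0 k γ')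
    have hnn : n < n' := by
      rw [← floorPow_succ_add k γ, ← floorPow_succ_add k γ', heq, hn, hn'] at hlt
      simpa [mul_lt_mul_iff_right₀ (omega0_pow_pos k)] using hlt
    obtain ⟨d, rfl⟩ := Nat.exists_eq_add_of_lt hnn
    have hstart : floorPow k γ + ω ^ k = floorPow (k + 1) γ' + ω ^ k * (n + 1 : ℕ) := by
      rw [← floorPow_succ_add k γ, heq, hn, add_assoc, ← mul_add_one, Nat.cast_add, Nat.cast_one]
    have hend : floorPow k γ + ω ^ k + ω ^ k * (d : ℕ) = floorPow k γ' := by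
      rw [hstart, ← floorPow_succ_add k γ', hn', add_assoc, ← mul_add, ← Nat.cast_add]
      congr 3
      omega
    refine main k hkm (hend ▸ le_self_add) fun h Hh => ?_
    rw [← hend] at Hh ⊢
    refine Hh.replace_blocks (fun h => Realizes.restrict_smallCoeff hm k)
      fun j hj y hy hyG => Or.inr ?_
    rw [hstart, add_assoc (floorPow (k + 1) γ'), ← mul_add, ← Nat.cast_add, add_assoc]
    refine mem_U_of_coeff_ne hkm (natCast_lt_omega0 _) hy hyG ?_ ?_
    · rw [hn']
      exact (Nat.cast_lt.2 (by omega)).ne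
    · rw [hn']
      exact (Nat.cast_le.2 (by omega)).trans le_self_add

end Segments

/-! ### From runs to acceptance, and assembly of the word -/

section Main

variable {Q : Type w} {S : Type v} {α : Ordinal.{u}} {blank : S}

/-- The automaton that reads `f s` in place of the letter `s`. -/
def OrdinalAutomaton.comap {T : Type*} (A : OrdinalAutomaton Q T) (f : S → T) :
    OrdinalAutomaton Q S where
  init := A.init
  final := A.final
  succTrans := {t | (t.1, f t.2.1, t.2.2) ∈ A.succTrans}
  limTrans := A.limTrans

theorem runRel_comap {T : Type*} (A : OrdinalAutomaton Q T) (f : S → T) (x : Ordinal.{u} → S)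
    (a b : Ordinal.{u}) : runRel (A.comap f) x a b = runRel A (fun y => f (x y)) a b :=
  Set.ext fun _ => exists_congr fun _ => and_congr_left fun _ =>
    ⟨fun h => ⟨h.succ, h.lim⟩, fun h => ⟨h.succ, h.lim⟩⟩

theorem cofinalSet_eq_limSet (r : Ordinal.{u} → Q) (β : Set.Iic α) :
    cofinalSet r β = limSet (fun x : Set.Iic α => r x) β := by
  ext q
  constructor
  · rintro h ⟨β', hβ'α⟩ hβ'
    obtain ⟨x, h1, h2, h3⟩ := h β' hβ'
    exact ⟨⟨x, h2.le.trans β.2⟩, h1, h2, h3⟩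
  · intro h β' hβ'
    obtain ⟨x, h1, h2, h3⟩ := h ⟨β', hβ'.le.trans β.2⟩ hβ'
    exact ⟨x, h1, h2, h3⟩

theorem runOn_iff_isRun (A : OrdinalAutomaton Q S) (x : FinWord α S blank) {y : Ordinal.{u} → S}
    (hy : ∀ (β) (h : β < α), y β = x.letter ⟨β, h⟩) (r : Ordinal.{u} → Q) :
    RunOn A y 0 α r ↔ IsRun A x (fun β : Set.Iic α => r β) := by
  constructor
  · intro h
    refine ⟨fun β hβ => ?_, fun β hβ => ?_⟩
    · rw [← hy β hβ]
      exact h.succ β zero_le hβ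
    · rw [← cofinalSet_eq_limSet]
      exact h.lim β hβ.bot_lt β.2 hβ
  · intro h
    refine ⟨fun β _ hβ => ?_, fun β _ hβ hlim => ?_⟩
    · rw [hy β hβ]
      exact h.1 β hβ
    · have := h.2 ⟨β, hβ⟩ hlim
      rwa [← cofinalSet_eq_limSet] at this

theorem accepts_iff (A : OrdinalAutomaton Q S) (x : FinWord α S blank) {y : Ordinal.{u} → S}
    (hy : ∀ (β) (h : β < α), y β = x.letter ⟨β, h⟩) :
    Accepts A x ↔ ∃ z ∈ (show Set (Q × Q) from runRel A y 0 α), z.1 ∈ A.init ∧ z.2 ∈ A.final := by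
  classical
  constructor
  · rintro ⟨r, hr, h0, h1⟩
    have heq : (fun β : Set.Iic α => if h : (β : Ordinal.{u}) ≤ α then
        r ⟨β, Set.mem_Iic.2 h⟩ else r ⟨α, Set.mem_Iic.2 le_rfl⟩)
        = r := by
      ext β
      exact dif_pos β.2
    refine ⟨(r ⟨0, _⟩, r ⟨α, _⟩), ⟨fun β => if h : β ≤ α then r ⟨β, Set.mem_Iic.2 h⟩ else
      r ⟨α, Set.mem_Iic.2 le_rfl⟩, ?_, dif_pos zero_le, dif_pos le_rfl⟩, h0, h1⟩
    rw [runOn_iff_isRun A x hy, heq]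
    exact hr
  · rintro ⟨⟨q, q'⟩, ⟨r, hr, h0, h1⟩, h2, h3⟩
    dsimp only at h0 h1 h2 h3
    refine ⟨fun β => r β, (runOn_iff_isRun A x hy r).1 hr, ?_, ?_⟩
    · change r 0 ∈ A.init
      rwa [h0]
    · change r α ∈ A.final
      rwa [h1]

/-- The extension of a finite word by blanks. -/
noncomputable def FinWord.extend (x : FinWord α S blank) (β : Ordinal.{u}) : S :=
  open Classical in if h : β < α then x.letter ⟨β, h⟩ else blank

theorem FinWord.extend_of_lt (x : FinWord α S blank) {β : Ordinal.{u}} (h : β < α) :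
    x.extend β = x.letter ⟨β, h⟩ :=
  dif_pos h

theorem FinWord.mem_supp_iff (x : FinWord α S blank) (β : Ordinal.{u}) :
    β ∈ x.supp ↔ x.extend β ≠ blank := by
  by_cases h : β < α
  · simp [FinWord.supp, FinWord.extend, h]
  · simp [FinWord.supp, FinWord.extend, h]

theorem FinWord.finite_supp (x : FinWord α S blank) : x.supp.Finite := by
  refine (x.finite_support.image Subtype.val).subset ?_
  rintro β ⟨h, hβ⟩
  exact ⟨⟨β, h⟩, hβ, rfl⟩

/-- The word over `Fin (p + 1) → S` with components `x` and the words `e j`. -/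
noncomputable def consWord {p : ℕ} (x : Ordinal.{u} → S) (e : Fin p → FinWord α S blank)
    (β : Ordinal.{u}) : Fin (p + 1) → S :=
  Fin.cons (x β) fun j => (e j).extend β

theorem cons_mem_recognised_iff {p : ℕ} (A : OrdinalAutomaton Q (Fin (p + 1) → S))
    (x : FinWord α S blank) (e : Fin p → FinWord α S blank) :
    (Fin.cons x e : Fin (p + 1) → FinWord α S blank) ∈ recognised α blank A ↔
      ∃ z ∈ (show Set (Q × Q) from runRel A (consWord x.extend e) 0 α),
        z.1 ∈ A.init ∧ z.2 ∈ A.final := by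
  refine accepts_iff A _ fun β h => funext fun j => ?_
  refine Fin.cases ?_ (fun j => ?_) j
  · exact x.extend_of_lt h
  · exact (e j).extend_of_lt h

variable {n : ℕ} {p : Fin n → ℕ} [Finite Q]

/-- Induction along supp(E) ∪ {0, α}: up to the preceding point `γ` use the word already built, at
`γ` keep the letter of `v`, and on the gap after it take a replacement from
`Realizes.replace_segment`. -/
theorem exists_word (Φ : (i : Fin n) → OrdinalAutomaton Q (Fin (p i + 1) → S)) {m : ℕ}
    (hm : Nat.card (Fin n → StateRel Q) ≤ m) (hm' : Nat.card Q < m)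
    {E : Set (FinWord α S blank)} (hE : E.Finite) (v : FinWord α S blank) (δ : Ordinal.{u}) :
    δ ≤ α → δ ∈ suppSet E ∪ {0, α} → ∃ x : Ordinal.{u} → S, {β | x β ≠ blank}.Finite ∧
      (∀ β < δ, x β ≠ blank → β ∈ USet m (suppSet E) α) ∧
      ∀ (i : Fin n) (e : Fin (p i) → FinWord α S blank), (∀ j, e j ∈ E) →
        runRel (Φ i) (consWord x e) 0 δ = runRel (Φ i) (consWord v.extend e) 0 δ := by
  classical
  have hX : (suppSet E).Finite := hE.biUnion fun e _ => e.finite_supp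
  induction δ using WellFoundedLT.induction with
  | ind δ ih =>
  intro hδα hδ
  rcases eq_or_ne δ 0 with rfl | hδ0
  · exact ⟨fun _ => blank, by simp, fun β hβ => absurd hβ not_lt_zero, fun i e _ => by
      rw [runRel_self, runRel_self]⟩
  obtain ⟨γ, ⟨hγX, hγδ⟩, hγmax⟩ := Set.exists_max_image ((suppSet E ∪ {0}) ∩ Set.Iio δ) id
    ((hX.union (Set.finite_singleton 0)).inter_of_left _)
    ⟨0, Or.inr rfl, pos_iff_ne_zero.2 hδ0⟩
  have hγδ : γ < δ := hγδ
  have hγU : γ ∈ suppSet E ∪ {0, α} := hγX.imp_right fun h => Or.inl h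
  obtain ⟨x, hx1, hx2, hx3⟩ := ih γ hγδ (hγδ.le.trans hδα) hγU
  -- On the gap all parameters are blank, so each automaton can be read as one over `S`, the same
  -- for every tuple `e`.
  let f : (i : Fin n) → S → Fin (p i + 1) → S := fun i s => Fin.cons s fun _ => blank
  have hv : {β | v.extend β ≠ blank}.Finite := v.finite_supp.subset fun β hβ =>
    (v.mem_supp_iff β).2 hβ
  have hR : Realizes (fun i => (Φ i).comap (f i)) blank (γ + 1) δ Set.univ
      (wordType (fun i => (Φ i).comap (f i)) v.extend (γ + 1) δ) :=
    ⟨v.extend, hv, fun _ _ _ _ => Set.mem_univ _, rfl⟩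
  obtain ⟨y, hy1, hy2, hy3⟩ := hR.replace_segment hm hm' hγδ
  have hUSet : ∀ ξ ∈ suppSet E ∪ {0, α}, ∀ β < α, β ∈ U m ξ → β ∈ USet m (suppSet E) α :=
    fun ξ hξ β hβ h => ⟨Set.mem_iUnion₂.2 ⟨ξ, hξ, h⟩, hβ⟩
  have hγ1 : γ < γ + 1 := lt_add_one γ
  have hγ1δ : γ + 1 ≤ δ := add_one_le_of_lt hγδ
  refine ⟨fun β => if β < γ then x β else if β = γ then v.extend β else y β,
    ((hx1.union hv).union hy1).subset fun β hβ => ?_, fun β hβδ hβ => ?_, fun i e he => ?_⟩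
  · simp only [Set.mem_ofPred_eq] at hβ
    split_ifs at hβ
    exacts [Or.inl (Or.inl hβ), Or.inl (Or.inr hβ), Or.inr hβ]
  · dsimp only at hβ
    split_ifs at hβ with h1 h2
    · exact hx2 β h1 hβ
    · exact hUSet γ hγU β (hβδ.trans_le hδα) (Or.inl h2)
    · have hγβ : γ + 1 ≤ β := add_one_le_of_lt ((not_lt.1 h1).lt_of_ne' h2)
      rcases hy2 β hγβ hβδ hβ with h | h
      · exact hUSet γ hγU β (hβδ.trans_le hδα) h
      · exact hUSet δ hδ β (hβδ.trans_le hδα) h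
  · have hblank : ∀ β, γ + 1 ≤ β → β < δ → ∀ z : Ordinal.{u} → S,
        consWord z e β = f i (z β) := by
      intro β h1 h2 z
      refine congrArg (Fin.cons (α := fun _ => S) (z β)) (funext fun j => ?_)
      by_contra hc
      have hβX : β ∈ suppSet E := Set.mem_iUnion₂.2 ⟨e j, he j, ((e j).mem_supp_iff β).2 hc⟩
      exact (hγmax β ⟨Or.inl hβX, h2⟩).not_gt (hγ1.trans_le h1)
    rw [← runRel_mul _ _ zero_le hγδ.le, ← runRel_mul _ _ zero_le hγδ.le,
      ← runRel_mul _ _ hγ1.le hγ1δ, ← runRel_mul _ _ hγ1.le hγ1δ]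
    congr 1
    · rw [← hx3 i e he]
      exact runRel_congr _ fun β _ hβ => by simp [consWord, hβ]
    · congr 1
      · refine runRel_congr _ fun β h1 h2 => ?_
        have : β = γ := le_antisymm (lt_add_one_iff.1 h2) h1
        simp [consWord, this]
      · have h3 := congrFun hy3 i
        simp only [wordType, runRel_comap] at h3
        rw [runRel_congr _ fun β h1 h2 => hblank β h1 h2 v.extend, ← h3]
        refine runRel_congr _ fun β h1 h2 => ?_
        rw [hblank β h1 h2]
        simp [(hγ1.trans_le h1).not_gt, (hγ1.trans_le h1).ne']

end Main

end OrdinalAutomata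


open OrdinalAutomata in
theorem mainTheorem1 {Q S : Type*} [Finite Q] [Finite S] (blank : S) (α : Ordinal)
    (n : ℕ) (p : Fin n → ℕ) (Φ : (i : Fin n) → OrdinalAutomaton Q (Fin (p i + 1) → S))
    (K : ℕ) (hK : K = Nat.card (Set (Q × Q)) ^ n + 1)
    (E : Set (FinWord α S blank)) (hE : E.Finite) (v : FinWord α S blank) :
    ∃ w : FinWord α S blank,
      w.supp ⊆ USet K (suppSet E) α ∧ Indistinguishable Φ E v w := by
  -- For `n = 0` the bound `K` is 2 and need not exceed |Q|, but nothing has to be preserved and the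
  -- blank word works.
  rcases Nat.eq_zero_or_pos n with rfl | hn
  · exact ⟨⟨fun _ => blank, by simp⟩, fun β ⟨_, h⟩ => absurd rfl h, fun i => i.elim0⟩
  have hM : Nat.card (Fin n → StateRel Q) = Nat.card (Set (Q × Q)) ^ n := by
    rw [Nat.card_fun, Nat.card_fin]
    rfl
  -- Together with the summand 1 in `K`, this yields the strict inequality |Q| < K needed for blank
  -- words.
  have hQ : Nat.card Q ≤ Nat.card (Set (Q × Q)) ^ n := by
    refine le_trans ?_ (Nat.le_self_pow hn.ne' _)
    exact Nat.card_le_card_of_injective (fun q => {(q, q)}) fun q q' h => by simpa using h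
  obtain ⟨x, hx1, hx2, hx3⟩ := exists_word (m := K) Φ (by omega) (by omega) hE v α le_rfl
    (Or.inr (Or.inr rfl))
  refine ⟨⟨fun β => x β, hx1.preimage Subtype.val_injective.injOn⟩, ?_, fun i e he => ?_⟩
  · rintro β ⟨hβ, h⟩
    exact hx2 β hβ h
  · rw [cons_mem_recognised_iff, cons_mem_recognised_iff, ← hx3 i e he]
    refine exists_congr fun z => and_congr_left fun _ => Eq.to_iff (congrArg (z ∈ ·) ?_)
    refine runRel_congr _ fun β _ hβ => ?_
    rw [consWord, consWord, FinWord.extend_of_lt _ hβ]
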